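/- Let $\mathcal H=(\mathbb C[\tau,\tau^{-1}]\otimes\mathbb C a)\oplus\mathbb C K$ be the Heisenberg Lie algebra, with $K$ central and $[\tau^n\otimes a,\tau^m\otimes a]=\delta_{n,-m}\,nK$. For $\mu\in\mathbb C$ let $M(\mu)$ be the Verma module over $\mathcal H$ with highest weight vector $v_\mu$: $(\tau^n\otimes a)v_\mu=0$ for $n>0$, $av_\mu=\mu v_\mu$, $Kv_\mu=v_\mu$. Write $a_n^\mu$ for the action of $\tau^n\otimes a$ on $M(\mu)$. Let $V=V^1(\mathbb C a)=M(0)$ be the free boson vertex algebra, with vacuum $\mathbf 1=v_0$, generated by the state $a=a_{-1}\mathbf 1$, and let $Y^\mu(b,z)$ $(b\in V)$ be the fields of the $V$-module $M(\mu)$, where $Y^\mu(a,z)=\sum_n a^\mu_nz^{-n-1}$. Let $t\in\sqrt{-1}\,\mathbb R$, let $L(t)=\tfrac12{:}aa{:}+t\,Ta\in V$, where $T$ is the translation operator, and let $L(t)_n$ be the operators on $V$ given by $Y(L(t),z)=\sum_nL(t)_nz^{-n-2}$. Let $\phi$ be the conjugate linear involution of the vertex algebra $V$ with $\phi(a)=-a$.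 For $b\in V$ with $L(t)_0b=\Delta_bb$ put $g(b)=e^{-\pi\sqrt{-1}\Delta_b}\phi(b)$, extend $g$ additively to $V$, and put $A(z,t)=e^{zL(t)_1}z^{-2L(t)_0}g$. A Hermitian form $H$ on $M(\mu)$, conjugate linear in the first argument, is called $L(t)$-invariant if $$H(m_1,Y^\mu(b,z)m_2)=H(Y^\mu(A(z,t)b,z^{-1})m_1,m_2)\qquad\text{for all } b\in V,\ m_1,m_2\in M(\mu).$$ (a) There is a non-zero $L(t)$-invariant Hermitian form on $M(\mu)$ if and only if $t=\sqrt{-1}\,\Im(\mu)$. (b) If $t=\sqrt{-1}\,\Im(\mu)$, there is a unique $L(t)$-invariant Hermitian form $H_\mu$ on $M(\mu)$ with $H_\mu(v_\mu,v_\mu)=1$. It is positive definite. The monomials $(a^\mu_{-j_1})^{i_1}\cdots(a^\mu_{-j_r})^{i_r}v_\mu$, with $r\ge0$, $j_1>\dots>j_r>0$ and $i_1,\dots,i_r>0$, form a basis of $M(\mu)$ which is orthogonal for $H_\mu$, and $m=(a^\mu_{-j_1})^{i_1}\cdots(a^\mu_{-j_r})^{i_r}v_\mu$ satisfies $$H_\mu(m,m)=\prod_{s=1}^r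 i_s!\,j_s^{i_s}.$$ -/

import Mathlib

noncomputable section

namespace FreeBoson

attribute [local instance] LieRing.ofAssociativeRing

/-! ### The Heisenberg Lie algebra `ℋ = (ℂ[τ, τ⁻¹] ⊗ ℂ a) ⊕ ℂ K` -/

/-- The underlying space of `ℋ`: the pair `(x, c)` stands for `∑ xₙ τⁿ ⊗ a + c K`. -/
def Heis : Type := (ℤ →₀ ℂ) × ℂ

namespace Heis

instance : AddCommGroup Heis := inferInstanceAs (AddCommGroup ((ℤ →₀ ℂ) × ℂ))

instance : Module ℂ Heis := inferInstanceAs (Module ℂ ((ℤ →₀ ℂ) × ℂ))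

/-- The element `τⁿ ⊗ a`. -/
def a (n : ℤ) : Heis := (Finsupp.single n 1, 0)

/-- The central element `K`. -/
def K : Heis := (0, 1)

/-- The cocycle `(τⁿ ⊗ a, τᵐ ⊗ a) ↦ δ_{n,-m} n`. -/
def cocycle : (ℤ →₀ ℂ) →ₗ[ℂ] (ℤ →₀ ℂ) →ₗ[ℂ] ℂ :=
  Finsupp.lsum ℂ fun n : ℤ =>
    LinearMap.toSpanSingleton ℂ ((ℤ →₀ ℂ) →ₗ[ℂ] ℂ) ((n : ℂ) • Finsupp.lapply (-n))

lemma cocycle_single (n m : ℤ) (c d : ℂ) :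
    cocycle (Finsupp.single n c) (Finsupp.single m d) = if n = -m then n * (c * d) else 0 := by
  by_cases h : n = -m
  · subst h
    simp [cocycle]
    ring
  · have h' : m ≠ -n := fun e => h (by omega)
    simp [cocycle, h, h']

lemma cocycle_neg (x y : ℤ →₀ ℂ) : cocycle x y = -cocycle y x := by
  have : cocycle = -cocycle.flip := by
    ext n m
    simp only [LinearMap.coe_comp, Function.comp_apply, Finsupp.lsingle_apply,
      LinearMap.neg_apply, LinearMap.flip_apply, cocycle_single]
    by_cases h : n = -m
    · subst h
      simp
    · have h' : m ≠ -n := fun e => h (by omega)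
      simp [h, h']
  exact congrArg (fun f => f x y) this

lemma cocycle_self (x : ℤ →₀ ℂ) : cocycle x x = 0 :=
  self_eq_neg.mp (cocycle_neg x x)

instance : LieRing Heis where
  bracket x y := (0, cocycle x.1 y.1)
  add_lie x y z := Prod.ext (by exact (add_zero _).symm)
    (by exact congrArg (fun f => f z.1) (map_add cocycle x.1 y.1))
  lie_add x y z := Prod.ext (by exact (add_zero _).symm) (by exact map_add (cocycle x.1) y.1 z.1)
  lie_self x := Prod.ext rfl (cocycle_self x.1)
  leibniz_lie x y z := Prod.ext (by exact (add_zero _).symm) (by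
    change cocycle x.1 0 = cocycle 0 z.1 + cocycle y.1 0
    simp)

instance : LieAlgebra ℂ Heis where
  lie_smul c x y := Prod.ext (by exact (smul_zero _).symm) (by exact map_smul (cocycle x.1) c y.1)

lemma lie_def (x y : Heis) : ⁅x, y⁆ = ((0, cocycle x.1 y.1) : Heis) := rfl

end Heis

/-! ### Verma modules -/

/-- The universal enveloping algebra of `ℋ`. -/
abbrev UH : Type := UniversalEnvelopingAlgebra ℂ Heis

/-- The inclusion of `ℋ` in its enveloping algebra. -/
abbrev inc : Heis →ₗ[ℂ] UH := (UniversalEnvelopingAlgebra.ι ℂ : Heis →ₗ⁅ℂ⁆ UH).toLinearMap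

/-- The left ideal of the enveloping algebra generated by `τⁿ ⊗ a` for `n > 0`, `a - μ`
and `K - 1`. -/
def vermaIdeal (μ : ℂ) : Submodule UH UH :=
  Submodule.span UH
    ({u | ∃ n : ℤ, 0 < n ∧ u = inc (Heis.a n)} ∪
      {inc (Heis.a 0) - algebraMap ℂ UH μ, inc Heis.K - 1})

/-- The Verma module `M(μ)` of `ℋ`, of highest weight `a ↦ μ`, `K ↦ 1`. -/
abbrev Verma (μ : ℂ) : Type := UH ⧸ vermaIdeal μ

/-- The highest weight vector `v_μ`. -/
def hw (μ : ℂ) : Verma μ := Submodule.Quotient.mk 1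

/-- The operator `a_n^μ` on `M(μ)`, i.e. the action of `τⁿ ⊗ a`. -/
def mode (μ : ℂ) (n : ℤ) : Module.End ℂ (Verma μ) where
  toFun v := inc (Heis.a n) • v
  map_add' := smul_add _
  map_smul' c v := by
    rw [RingHom.id_apply, ← algebraMap_smul UH c v, ← algebraMap_smul UH c (inc (Heis.a n) • v),
      smul_smul, smul_smul, Algebra.commutes]

lemma mode_apply (μ : ℂ) (n : ℤ) (v : Verma μ) : mode μ n v = inc (Heis.a n) • v := rfl

/-- The monomial `(a_{-j₁})^{i₁} ⋯ (a_{-j_r})^{i_r} v_μ` with `j₁ > ⋯ > j_r > 0`, where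
`{j₁, …, j_r}` is the support of `s` and `i_l = s j_l`. -/
def monom (μ : ℂ) (s : ℕ+ →₀ ℕ) : Verma μ :=
  ((s.support.sort (· ≥ ·)).map fun j : ℕ+ => mode μ (-((j : ℕ) : ℤ)) ^ s j).prod (hw μ)

/-! ### The polynomial algebra `ℂ[x₁, x₂, …]` and the Verma modules -/

/-- The polynomial algebra in the variables `x_j`, `j > 0`. -/
abbrev Poly : Type := MvPolynomial ℕ+ ℂ

/-- The action of `τⁿ ⊗ a` on polynomials: multiplication by `x_{-n}` for `n < 0`, the scalar `μ`
for `n = 0`, and `n ∂/∂x_n` for `n > 0`. -/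
def polyMode (μ : ℂ) : ℤ → Module.End ℂ Poly
  | Int.ofNat 0 => μ • 1
  | Int.ofNat (k + 1) => ((k : ℂ) + 1) • (MvPolynomial.pderiv k.succPNat).toLinearMap
  | Int.negSucc k => LinearMap.mulLeft ℂ (MvPolynomial.X k.succPNat)

lemma pderiv_comm (i j : ℕ+) (p : Poly) :
    MvPolynomial.pderiv i (MvPolynomial.pderiv j p) =
      MvPolynomial.pderiv j (MvPolynomial.pderiv i p) := by
  have h : ⁅(MvPolynomial.pderiv i : Derivation ℂ Poly Poly),
      (MvPolynomial.pderiv j : Derivation ℂ Poly Poly)⁆ = 0 := by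
    refine MvPolynomial.derivation_ext fun k => ?_
    classical
    simp only [Derivation.commutator_apply, MvPolynomial.pderiv_X, Pi.single_apply,
      Derivation.coe_zero, Pi.zero_apply]
    split_ifs <;> simp
  have h' := DFunLike.congr_fun h p
  simp only [Derivation.commutator_apply, Derivation.coe_zero, Pi.zero_apply] at h'
  exact sub_eq_zero.mp h'

lemma polyMode_comm_pos_neg (μ : ℂ) (k l : ℕ) (p : Poly) :
    polyMode μ (Int.ofNat (k + 1)) (polyMode μ (Int.negSucc l) p) =
      polyMode μ (Int.negSucc l) (polyMode μ (Int.ofNat (k + 1)) p) +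
        if k = l then ((k : ℂ) + 1) • p else 0 := by
  by_cases h : k = l
  · subst h
    simp [polyMode, Derivation.leibniz, add_comm]
  · have h' : l.succPNat ≠ k.succPNat := fun e => h (Nat.succPNat_injective e).symm
    simp [polyMode, Derivation.leibniz, h, MvPolynomial.pderiv_X_of_ne h']

lemma polyMode_comm (μ : ℂ) (n m : ℤ) :
    polyMode μ n * polyMode μ m - polyMode μ m * polyMode μ n
      = if n = -m then (n : ℂ) • 1 else 0 := by
  refine LinearMap.ext fun p => ?_
  match n, m with
  | Int.ofNat 0, m =>
    simp [polyMode]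
  | Int.ofNat (k + 1), Int.ofNat 0 =>
    have h : ¬ ((k : ℤ) + 1 = 0) := by omega
    simp [polyMode, h, smul_comm μ]
  | Int.negSucc k, Int.ofNat 0 => simp [polyMode]
  | Int.ofNat (k + 1), Int.ofNat (l + 1) =>
    have h : ¬ (Int.ofNat (k + 1) = -Int.ofNat (l + 1)) := by
      simp only [Int.ofNat_eq_natCast]
      omega
    rw [if_neg h]
    simp [polyMode, pderiv_comm l.succPNat, smul_comm ((l : ℂ) + 1)]
  | Int.negSucc k, Int.negSucc l =>
    have h : ¬ (Int.negSucc k = -Int.negSucc l) := by omega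
    rw [if_neg h]
    simp [polyMode]
    ring
  | Int.ofNat (k + 1), Int.negSucc l =>
    have h := polyMode_comm_pos_neg μ k l p
    rw [LinearMap.sub_apply, Module.End.mul_apply, Module.End.mul_apply, h, add_sub_cancel_left]
    by_cases e : k = l
    · subst e
      rw [if_pos rfl, if_pos (by rfl)]
      simp
    · rw [if_neg e, if_neg (by simp only [Int.ofNat_eq_natCast]; omega)]
      rfl
  | Int.negSucc k, Int.ofNat (l + 1) =>
    have h := polyMode_comm_pos_neg μ l k p
    rw [LinearMap.sub_apply, Module.End.mul_apply, Module.End.mul_apply, h, sub_add_cancel_left]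
    by_cases e : l = k
    · subst e
      rw [if_pos rfl, if_pos (by rfl)]
      simp only [LinearMap.smul_apply, Module.End.one_apply, ← neg_smul, Int.cast_negSucc]
      push_cast
      rfl
    · rw [if_neg e, if_neg (by simp only [Int.ofNat_eq_natCast]; omega)]
      simp

/-- The polynomial representation of `ℋ` in which `K` acts as `1`. -/
def polyRep (μ : ℂ) : Heis →ₗ⁅ℂ⁆ Module.End ℂ Poly where
  toFun x := Finsupp.lsum ℂ (fun n => LinearMap.toSpanSingleton ℂ _ (polyMode μ n)) x.1 + x.2 • 1
  map_add' x y := by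
    change Finsupp.lsum ℂ _ (x.1 + y.1) + (x.2 + y.2) • 1 = _
    rw [map_add, add_smul]
    abel
  map_smul' c x := by
    change Finsupp.lsum ℂ _ (c • x.1) + (c * x.2) • 1 = _
    rw [map_smul, mul_smul, RingHom.id_apply, smul_add]
  map_lie' := by
    intro x y
    change Finsupp.lsum ℂ _ (0 : ℤ →₀ ℂ) + Heis.cocycle x.1 y.1 • 1 = _
    rw [map_zero, zero_add, LieRing.of_associative_ring_bracket]
    set F := Finsupp.lsum ℂ (fun n => LinearMap.toSpanSingleton ℂ _ (polyMode μ n)) with hF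
    have key : ∀ X Z : ℤ →₀ ℂ,
        Heis.cocycle X Z • (1 : Module.End ℂ Poly) = F X * F Z - F Z * F X := by
      intro X Z
      induction X using Finsupp.induction_linear with
      | zero => simp
      | add X X' h h' =>
        simp only [map_add, LinearMap.add_apply, add_smul, h, h', add_mul, mul_add]
        abel
      | single n c =>
        induction Z using Finsupp.induction_linear with
        | zero => simp
        | add Z Z' h h' =>
          simp only [map_add, add_smul, h, h', add_mul, mul_add]
          abel
        | single m d =>
          have h := polyMode_comm μ n m
          simp only [Heis.cocycle_single, hF, Finsupp.lsum_single,
            LinearMap.toSpanSingleton_apply, smul_mul_smul_comm]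
          rw [mul_comm d c, ← smul_sub, h]
          split_ifs
          · rw [smul_smul, mul_comm]
          · simp
    change _ = (F x.1 + x.2 • 1) * (F y.1 + y.2 • 1) - (F y.1 + y.2 • 1) * (F x.1 + x.2 • 1)
    rw [key]
    generalize F x.1 = p, F y.1 = q, x.2 = c, y.2 = d
    simp only [add_mul, mul_add, smul_mul_assoc, mul_smul_comm, one_mul, mul_one, smul_add,
      smul_comm d c]
    abel

lemma polyRep_a (μ : ℂ) (n : ℤ) : polyRep μ (Heis.a n) = polyMode μ n := by
  change Finsupp.lsum ℂ (fun n => LinearMap.toSpanSingleton ℂ _ (polyMode μ n))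
    (Finsupp.single n 1) + (0 : ℂ) • 1 = _
  simp

lemma polyRep_K (μ : ℂ) : polyRep μ Heis.K = 1 := by
  change Finsupp.lsum ℂ (fun n => LinearMap.toSpanSingleton ℂ _ (polyMode μ n)) 0 + (1 : ℂ) • 1 = _
  simp

lemma lift_inc (μ : ℂ) (x : Heis) :
    UniversalEnvelopingAlgebra.lift ℂ (polyRep μ) (inc x) = polyRep μ x :=
  UniversalEnvelopingAlgebra.lift_ι_apply ℂ (polyRep μ) x

/-- The linear map `M(μ) → ℂ[x₁, x₂, …]`, `u v_μ ↦ u · 1`, which is the inverse of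
`x_{j₁} ⋯ x_{j_r} ↦ a_{-j₁} ⋯ a_{-j_r} v_μ`. -/
def symbol (μ : ℂ) : Verma μ →ₗ[ℂ] Poly :=
  (((vermaIdeal μ).restrictScalars ℂ).liftQ
    ((LinearMap.applyₗ (1 : Poly)).comp
      (UniversalEnvelopingAlgebra.lift ℂ (polyRep μ)).toLinearMap) (by
        intro u hu
        induction hu using Submodule.span_induction with
        | mem u hu =>
          rw [LinearMap.mem_ker, LinearMap.comp_apply, LinearMap.applyₗ_apply_apply,
            AlgHom.toLinearMap_apply]
          rcases hu with ⟨n, hn, rfl⟩ | rfl | rfl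
          · obtain ⟨k, rfl⟩ : ∃ k : ℕ, n = Int.ofNat (k + 1) :=
              ⟨(n - 1).toNat, by simp; omega⟩
            rw [lift_inc, polyRep_a]
            simp [polyMode]
          · rw [map_sub, lift_inc, polyRep_a, AlgHom.commutes, LinearMap.sub_apply]
            change μ • (1 : Poly) - (algebraMap ℂ (Module.End ℂ Poly) μ) 1 = 0
            rw [Module.algebraMap_end_apply, sub_self]
          · rw [map_sub, lift_inc, polyRep_K,
              map_one (UniversalEnvelopingAlgebra.lift ℂ (polyRep μ)), sub_self, LinearMap.zero_apply]
        | zero => exact zero_mem _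
        | add u v _ _ hu hv => exact add_mem hu hv
        | smul w u _ hu =>
          rw [LinearMap.mem_ker] at hu ⊢
          simp only [LinearMap.comp_apply, LinearMap.applyₗ_apply_apply, AlgHom.toLinearMap_apply,
            smul_eq_mul, map_mul, Module.End.mul_apply] at hu ⊢
          rw [hu, map_zero])).comp
    (Submodule.Quotient.restrictScalarsEquiv ℂ (vermaIdeal μ)).symm.toLinearMap

/-- The linear map `ℂ[x₁, x₂, …] → M(μ)`, `x_{j₁} ⋯ x_{j_r} ↦ a_{-j₁} ⋯ a_{-j_r} v_μ`. -/
def realize (μ : ℂ) : Poly →ₗ[ℂ] Verma μ :=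
  (MvPolynomial.basisMonomials ℕ+ ℂ).constr ℂ (monom μ)

/-! ### Fields -/

section Fields

variable {M : Type} [AddCommGroup M] [Module ℂ M]

open HVertexOperator

lemma exists_coeff_eq_zero (A : VertexOperator ℂ M) (v : M) :
    ∃ N : ℤ, ∀ k < N, coeff A k v = 0 :=
  ⟨_, fun k hk => VertexOperator.coeff_eq_zero_of_lt_order A k v hk⟩

/-- The divided derivative `∂^k A(z) / k!` of a field. -/
def dderiv (k : ℕ) (A : VertexOperator ℂ M) : VertexOperator ℂ M :=
  VertexOperator.of_coeff (fun n => Ring.choose (n + k) k • coeff A (n + k)) (by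
    intro v
    obtain ⟨N, hN⟩ := exists_coeff_eq_zero A v
    refine ⟨N - k, fun n hn => ?_⟩
    by_contra hlt
    apply hn
    change Ring.choose (n + k) k • coeff A (n + k) v = 0
    rw [hN (n + k) (by omega), smul_zero])

lemma nprod_finite_left (A B : VertexOperator ℂ M) (n : ℤ) (v : M) :
    (Function.support fun i : ℕ => coeff A (i : ℤ) (coeff B (n - i) v)).Finite := by
  obtain ⟨N, hN⟩ := exists_coeff_eq_zero B v
  refine (Set.finite_Iic (n - N).toNat).subset fun i hi => ?_
  by_contra hlt
  apply hi
  simp only [Set.mem_Iic, not_le] at hlt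
  simp only [hN (n - i) (by omega), map_zero]

lemma nprod_finite_right (A B : VertexOperator ℂ M) (n : ℤ) (v : M) :
    (Function.support fun i : ℕ =>
      coeff B (n + i + 1) (coeff A (-(i : ℤ) - 1) v)).Finite := by
  obtain ⟨N, hN⟩ := exists_coeff_eq_zero A v
  refine (Set.finite_Iic (-N).toNat).subset fun i hi => ?_
  by_contra hlt
  apply hi
  simp only [Set.mem_Iic, not_le] at hlt
  simp only [hN (-(i : ℤ) - 1) (by omega), map_zero]

/-- The normally ordered product `:A(z)B(z): = A(z)₋ B(z) + B(z) A(z)₊`, where `A(z)₋` collects the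
powers `zⁱ` with `i ≥ 0` and `A(z)₊` those with `i < 0`. Both sums are finite on each vector. -/
def nprod (A B : VertexOperator ℂ M) : VertexOperator ℂ M :=
  VertexOperator.of_coeff
    (fun n =>
      { toFun := fun v =>
          (∑ᶠ i : ℕ, coeff A (i : ℤ) (coeff B (n - i) v)) +
            ∑ᶠ i : ℕ, coeff B (n + i + 1) (coeff A (-(i : ℤ) - 1) v)
        map_add' := fun v w => by
          simp only [map_add]
          rw [finsum_add_distrib (nprod_finite_left A B n v) (nprod_finite_left A B n w),
            finsum_add_distrib (nprod_finite_right A B n v) (nprod_finite_right A B n w)]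
          abel
        map_smul' := fun c v => by
          simp only [map_smul, RingHom.id_apply, smul_add]
          rw [smul_finsum' c (nprod_finite_left A B n v),
            smul_finsum' c (nprod_finite_right A B n v)] })
    (by
      intro v
      obtain ⟨N, hN⟩ := exists_coeff_eq_zero B v
      obtain ⟨P, hP⟩ := exists_coeff_eq_zero A v
      choose Q hQ using fun i : ℕ => exists_coeff_eq_zero B (coeff A (-(i : ℤ) - 1) v)
      obtain ⟨R, hR⟩ : ∃ R : ℤ, ∀ i ∈ Finset.range (-P).toNat, R ≤ Q i - i - 1 := by
        obtain ⟨R, hR⟩ := ((Finset.range (-P).toNat).image fun i => Q i - i - 1).bddBelow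
        exact ⟨R, fun i hi => hR (by
          exact_mod_cast Finset.mem_image_of_mem (fun i : ℕ => Q i - i - 1) hi)⟩
      refine ⟨min N R, fun n hn => ?_⟩
      by_contra hlt
      apply hn
      rw [not_le, lt_min_iff] at hlt
      change (∑ᶠ i : ℕ, coeff A (i : ℤ) (coeff B (n - i) v)) +
        ∑ᶠ i : ℕ, coeff B (n + i + 1) (coeff A (-(i : ℤ) - 1) v) = 0
      rw [finsum_eq_zero_of_forall_eq_zero, finsum_eq_zero_of_forall_eq_zero, add_zero]
      · intro i
        by_cases hi : i < (-P).toNat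
        · have := hR i (Finset.mem_range.mpr hi)
          exact hQ i _ (by omega)
        · rw [hP _ (by omega), map_zero]
      · intro i
        rw [hN _ (by omega), map_zero])

/-- The identity field. -/
def idField : VertexOperator ℂ M :=
  VertexOperator.of_coeff (fun n => if n = 0 then 1 else 0) (by
    intro v
    refine ⟨0, fun n hn => ?_⟩
    by_contra hlt
    apply hn
    simp [show n ≠ 0 by omega])

end Fields

lemma mkAlgHom_surjective :
    Function.Surjective (UniversalEnvelopingAlgebra.mkAlgHom ℂ Heis) :=
  RingCon.mkₐ_surjective _

lemma mode_bounded (μ : ℂ) (v : Verma μ) : ∃ N : ℤ, ∀ n > N, mode μ n v = 0 := by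
  have key : ∀ u : UH, ∀ v : Verma μ, (∃ N : ℤ, ∀ n > N, mode μ n v = 0) →
      ∃ N : ℤ, ∀ n > N, mode μ n (u • v) = 0 := by
    intro u
    obtain ⟨w, rfl⟩ := mkAlgHom_surjective u
    induction w using TensorAlgebra.induction with
    | algebraMap c =>
      rintro v ⟨N, hN⟩
      refine ⟨N, fun n hn => ?_⟩
      rw [AlgHom.commutes, algebraMap_smul, map_smul, hN n hn, smul_zero]
    | ι x =>
      rintro v ⟨N, hN⟩
      obtain ⟨P, hP⟩ := x.1.support.finite_toSet.bddBelow
      refine ⟨max N (-P), fun n hn => ?_⟩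
      rw [gt_iff_lt, max_lt_iff] at hn
      have h0 : ⁅Heis.a n, x⁆ = 0 := by
        rw [Heis.lie_def]
        refine Prod.ext rfl ?_
        have hx : x.1 (-n) = 0 := by
          by_contra hne
          have := hP (Finset.mem_coe.mpr (Finsupp.mem_support_iff.mpr hne))
          omega
        change Heis.cocycle (Finsupp.single n 1) x.1 = 0
        simp [Heis.cocycle, hx]
      have hc : inc (Heis.a n) * inc x = inc x * inc (Heis.a n) := by
        have h := LieHom.map_lie (UniversalEnvelopingAlgebra.ι ℂ : Heis →ₗ⁅ℂ⁆ UH) (Heis.a n) x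
        rw [h0, map_zero, LieRing.of_associative_ring_bracket] at h
        exact (sub_eq_zero.mp h.symm)
      have hm : UniversalEnvelopingAlgebra.mkAlgHom ℂ Heis (TensorAlgebra.ι ℂ x) = inc x := rfl
      rw [hm, mode_apply, smul_smul, hc, ← smul_smul, ← mode_apply, hN n hn.1, smul_zero]
    | mul x y hx hy =>
      intro v hv
      rw [map_mul]
      simpa only [mul_smul] using hx _ (hy v hv)
    | add x y hx hy =>
      intro v hv
      obtain ⟨N, hN⟩ := hx v hv
      obtain ⟨P, hP⟩ := hy v hv
      refine ⟨max N P, fun n hn => ?_⟩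
      rw [gt_iff_lt, max_lt_iff] at hn
      rw [map_add, add_smul, map_add, hN n hn.1, hP n hn.2, add_zero]
  obtain ⟨u, rfl⟩ := Submodule.Quotient.mk_surjective _ v
  have h := key u (hw μ) ⟨0, fun n hn => ?_⟩
  · rwa [hw, ← Submodule.Quotient.mk_smul, smul_eq_mul, mul_one] at h
  · rw [mode_apply, hw, ← Submodule.Quotient.mk_smul, smul_eq_mul, mul_one,
      Submodule.Quotient.mk_eq_zero]
    exact Submodule.subset_span (Or.inl ⟨n, hn, rfl⟩)

/-- The field `a(z) = ∑ₙ a_n^μ z^{-n-1}` on `M(μ)`. -/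
def aField (μ : ℂ) : VertexOperator ℂ (Verma μ) :=
  VertexOperator.of_coeff (fun k => mode μ (-k - 1)) (by
    intro v
    obtain ⟨N, hN⟩ := mode_bounded μ v
    refine ⟨-N - 1, fun k hk => ?_⟩
    by_contra hlt
    exact hk (hN _ (by omega)))

/-! ### The vertex algebra `V¹(ℂ a) = M(0)` and its modules `M(μ)` -/

/-- The vertex algebra of the free boson, as a vector space; its vacuum vector is `hw 0`. -/
abbrev V : Type := Verma 0

/-- The state-field correspondence `b ↦ Y^μ(b, z)` of the `V`-module `M(μ)` (of `V` itself if
`μ = 0`): it sends `a_{-j₁} a_{-j₂} ⋯ a_{-j_r} 𝟏`, `j₁ ≥ j₂ ≥ ⋯ ≥ j_r`, to the normally ordered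
product `:∂^{(j₁-1)}a(z) (:∂^{(j₂-1)}a(z) ⋯ ∂^{(j_r-1)}a(z):):`. -/
def Y (μ : ℂ) : V →ₗ[ℂ] VertexOperator ℂ (Verma μ) :=
  ((MvPolynomial.basisMonomials ℕ+ ℂ).constr ℂ fun s : ℕ+ →₀ ℕ =>
    ((s.toMultiset.sort (· ≥ ·)).map fun j : ℕ+ => dderiv ((j : ℕ) - 1) (aField μ)).foldr
      nprod idField).comp (symbol 0)

/-- The coefficient of `zⁿ` in `Y^μ(b, z)`. -/
abbrev Ycoeff (μ : ℂ) (b : V) (n : ℤ) : Module.End ℂ (Verma μ) :=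
  HVertexOperator.coeff (Y μ b) n

/-- The state `a = a_{-1} 𝟏`. -/
def aState : V := mode 0 (-1) (hw 0)

/-- The translation operator of `V`, `T b = b_{(-2)} 𝟏`. -/
def T (b : V) : V := Ycoeff 0 b 1 (hw 0)

/-- The normally ordered product of states, `:bc: = b_{(-1)} c`. -/
def stateProd (b c : V) : V := Ycoeff 0 b 0 c

/-- The conformal vector `L(t) = ½ :aa: + t T a`. -/
def L (t : ℂ) : V := (1 / 2 : ℂ) • stateProd aState aState + t • T aState

/-- The operators `L(t)_n` on `V`, `Y(L(t), z) = ∑ₙ L(t)_n z^{-n-2}`. -/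
def Lmode (t : ℂ) (n : ℤ) : Module.End ℂ V := Ycoeff 0 (L t) (-n - 2)

/-- The conjugate linear ring automorphism of `ℂ[x₁, x₂, …]` with `x_j ↦ -x_j`. -/
def polyConj : Poly →ₛₗ[starRingEnd ℂ] Poly where
  toFun := MvPolynomial.eval₂Hom (MvPolynomial.C.comp (starRingEnd ℂ)) fun j => -MvPolynomial.X j
  map_add' := map_add _
  map_smul' c p := by
    rw [MvPolynomial.smul_eq_C_mul, map_mul, MvPolynomial.smul_eq_C_mul]
    simp

/-- The conjugate linear involution `φ` of the vertex algebra `V` with `φ(a) = -a`, i.e.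
`φ(c a_{-j₁} ⋯ a_{-j_r} 𝟏) = c̄ (-1)^r a_{-j₁} ⋯ a_{-j_r} 𝟏`. -/
def phi : V →ₛₗ[starRingEnd ℂ] V :=
  (realize 0).comp (polyConj.comp (symbol 0))

/-- For `b ∈ V` of conformal weight `Δ` put `g(b) = e^{-π√-1 Δ} φ(b)` and
`A(z, t) b = e^{z L(t)₁} z^{-2 L(t)₀} g(b) = ∑ₖ z^{k - 2Δ} L(t)₁ᵏ g(b) / k!`.
This is the coefficient of `z^{k - 2Δ}` in `A(z, t) b`; it is zero for almost all `k`. -/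
def Acoeff (t : ℂ) (Δ : ℤ) (b : V) (k : ℕ) : V :=
  ((k.factorial : ℂ)⁻¹ * Complex.exp (-(Real.pi * Complex.I * Δ))) • (Lmode t 1 ^ k) (phi b)

/-- Sesquilinear forms on `M(μ)`, conjugate linear in the first argument. -/
abbrev SesqForm (μ : ℂ) : Type := Verma μ →ₗ⋆[ℂ] Verma μ →ₗ[ℂ] ℂ

/-- `L(t)`-invariance of a form on `M(μ)`:
`H(m₁, Y^μ(b, z) m₂) = H(Y^μ(A(z, t) b, z⁻¹) m₁, m₂)`, as an equality of the coefficients of all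
powers `zⁿ`. Both sides are additive in `b`, and `V` is spanned by the eigenvectors of `L(t)₀`, so
that `b` runs over these; the eigenvalue `Δ`, an integer, is the conformal weight. -/
def IsInvariantForm (μ t : ℂ) (H : SesqForm μ) : Prop :=
  ∀ (Δ : ℤ) (b : V), Lmode t 0 b = (Δ : ℂ) • b →
    ∀ (m₁ m₂ : Verma μ) (n : ℤ),
      H m₁ (Ycoeff μ b n m₂) =
        ∑ᶠ k : ℕ, H (Ycoeff μ (Acoeff t Δ b k) ((k : ℤ) - 2 * Δ - n) m₁) m₂

end FreeBoson

end

noncomputable section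

namespace FreeBoson

attribute [local instance] LieRing.ofAssociativeRing

/-! Invariance under all states is equivalent to a condition on the generator `a` alone. Since
$L(t)_1a=-2t\mathbf 1$ and $\phi(a)=-a$, one has $A(z,t)a=z^{-2}(a-2tz\mathbf 1)$, so invariance for
$b=a$ says that the adjoint of $a_n$ is $a_{-n}-2t\delta_{n,0}$. This is `IsContravariant`, and the
implication is `isContravariant_of_isInvariantForm`.

Contravariant forms are easy to classify. For $n=0$ both operators are scalars, and a non-zero form
forces $\mu=\overline{\mu-2t}$, i.e. $t=\sqrt{-1}\,\Im\mu$ as $t$ is imaginary. For $n\ne0$, moving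
creation operators across the form reduces every value to $H(v_\mu,v_\mu)$, whence uniqueness
(`IsContravariant.eq`). For existence, identify $M(\mu)$ with $\mathbb C[x_1,x_2,\dots]$, where
$a_{-j}$ is multiplication by $x_j$ and $a_j=j\partial_j$. These are adjoint for the form with
orthogonal monomials of square norm $\prod i_s!\,j_s^{i_s}$ (`polyForm_X_mul`), which is visibly
positive definite.

The substance is that contravariance implies invariance for every state
(`IsContravariant.isInvariantForm`). The proof is an induction on monomials: the field of $x_jp$ is
the normally ordered product of $\partial^{(j-1)}a(z)$ with the field of $p$. Three facts carry the
step. Taking adjoints exchanges creation and annihilation operators and so respects normal ordering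
(`IsContravariant.normalMode`). On polynomials $L(t)_1$ is a derivation, because $a_0=0$ on $V$, so
that $e^{zL(t)_1}$ is multiplicative (`expL_X_mul`). Finally, a Chu-Vandermonde identity
(`sum_choose_mul_modeCoeff`) turns the coefficients produced by $e^{zL(t)_1}x_j$ into those of
$\partial^{(j-1)}a$ at the opposite mode; `oppCoeff_X_mul` assembles the last two. -/

/-! ### Relations in the enveloping algebra and on Verma modules -/

lemma inc_mul_sub (x y : Heis) : inc x * inc y - inc y * inc x = inc ⁅x, y⁆ := by
  have h := LieHom.map_lie (UniversalEnvelopingAlgebra.ι ℂ : Heis →ₗ⁅ℂ⁆ UH) x y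
  rw [LieRing.of_associative_ring_bracket] at h
  exact h.symm

/-- An induction principle for the enveloping algebra of `ℋ`. -/
lemma UH_induction {P : UH → Prop} (hC : ∀ c : ℂ, P (algebraMap ℂ UH c))
    (hι : ∀ x : Heis, P (inc x)) (hmul : ∀ u v, P u → P v → P (u * v))
    (hadd : ∀ u v, P u → P v → P (u + v)) (u : UH) : P u := by
  obtain ⟨w, rfl⟩ := mkAlgHom_surjective u
  induction w using TensorAlgebra.induction with
  | algebraMap c => rw [AlgHom.commutes]; exact hC c
  | ι x => exact hι x
  | mul x y hx hy => rw [map_mul]; exact hmul _ _ hx hy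
  | add x y hx hy => rw [map_add]; exact hadd _ _ hx hy

lemma Heis_induction {P : Heis → Prop} (ha : ∀ n, P (Heis.a n)) (hK : P Heis.K)
    (hadd : ∀ x y, P x → P y → P (x + y)) (hsmul : ∀ (c : ℂ) x, P x → P (c • x)) (x : Heis) :
    P x := by
  obtain ⟨y, c⟩ := x
  have hx : ((y, c) : (ℤ →₀ ℂ) × ℂ) = (y, 0) + c • (0, 1) := by simp
  -- The decomposition `hx` lives in the underlying product, whose operations are definitionally
  -- those of `Heis`.
  refine Eq.mpr (congrArg P hx) (hadd (y, 0) (c • Heis.K) ?_ (hsmul c _ hK))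
  induction y using Finsupp.induction_linear with
  | zero => exact Eq.mp (congrArg P (zero_smul ℂ Heis.K)) (hsmul 0 _ hK)
  | add y z hy hz =>
    have h : ((y + z, 0) : (ℤ →₀ ℂ) × ℂ) = (y, 0) + (z, 0) := by simp
    exact Eq.mpr (congrArg P h) (hadd (y, 0) (z, 0) (hy (by simp)) (hz (by simp)))
  | single n d =>
    have h : ((Finsupp.single n d, 0) : (ℤ →₀ ℂ) × ℂ) = d • (Finsupp.single n 1, 0) := by simp
    exact Eq.mpr (congrArg P h) (hsmul d (Heis.a n) (ha n))

lemma inc_commute_of_central {x : Heis} (hx : ∀ y : Heis, ⁅x, y⁆ = 0) (u : UH) :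
    inc x * u = u * inc x := by
  refine UH_induction (P := fun u => inc x * u = u * inc x) (fun c => ?_) (fun y => ?_)
    (fun u v hu hv => ?_) (fun u v hu hv => ?_) u
  · exact (Algebra.commutes c (inc x)).symm
  · have h := inc_mul_sub x y
    rw [hx, map_zero] at h
    exact sub_eq_zero.mp h
  · rw [← mul_assoc, hu, mul_assoc, hv, mul_assoc]
  · rw [mul_add, hu, hv, add_mul]

lemma mk_eq_smul_hw (μ : ℂ) (u : UH) :
    (Submodule.Quotient.mk u : Verma μ) = u • hw μ := by
  rw [hw, ← Submodule.Quotient.mk_smul, smul_eq_mul, mul_one]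

/-- The module is generated by `hw μ`, so a central element acts everywhere by its scalar on that
vector. -/
lemma central_smul (μ : ℂ) {x : Heis} (hx : ∀ y : Heis, ⁅x, y⁆ = 0) {c : ℂ}
    (h : inc x • hw μ = c • hw μ) (v : Verma μ) : inc x • v = c • v := by
  obtain ⟨u, rfl⟩ := Submodule.Quotient.mk_surjective _ v
  rw [mk_eq_smul_hw, smul_smul, inc_commute_of_central hx, mul_smul, h,
    ← algebraMap_smul UH c (hw μ), ← algebraMap_smul UH c (u • hw μ), smul_smul, smul_smul,
    Algebra.commutes]

lemma K_lie (y : Heis) : ⁅Heis.K, y⁆ = 0 := by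
  rw [Heis.lie_def]
  refine Prod.ext rfl ?_
  change Heis.cocycle 0 y.1 = 0
  simp

lemma a_zero_lie (y : Heis) : ⁅Heis.a 0, y⁆ = 0 := by
  rw [Heis.lie_def]
  refine Prod.ext rfl ?_
  change Heis.cocycle (Finsupp.single 0 1) y.1 = 0
  simp [Heis.cocycle]

lemma K_smul (μ : ℂ) (v : Verma μ) : inc Heis.K • v = v := by
  rw [central_smul μ K_lie (c := 1), one_smul]
  rw [one_smul, ← mk_eq_smul_hw, hw, Submodule.Quotient.eq]
  exact Submodule.subset_span (Or.inr (Or.inr rfl))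

lemma mode_zero (μ : ℂ) (v : Verma μ) : mode μ 0 v = μ • v := by
  rw [mode_apply]
  refine central_smul μ a_zero_lie ?_ v
  rw [← algebraMap_smul UH μ (hw μ), ← mk_eq_smul_hw, ← mk_eq_smul_hw, Submodule.Quotient.eq]
  exact Submodule.subset_span (Or.inr (Or.inl rfl))

lemma mode_pos_hw (μ : ℂ) {n : ℤ} (hn : 0 < n) : mode μ n (hw μ) = 0 := by
  rw [mode_apply, ← mk_eq_smul_hw, Submodule.Quotient.mk_eq_zero]
  exact Submodule.subset_span (Or.inl ⟨n, hn, rfl⟩)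

lemma inc_a_lie (n m : ℤ) :
    inc ⁅Heis.a n, Heis.a m⁆ = (if n = -m then (n : ℂ) else 0) • inc Heis.K := by
  rw [← map_smul, Heis.lie_def]
  congr 1
  refine Prod.ext (by exact (smul_zero _).symm) ?_
  change Heis.cocycle (Finsupp.single n 1) (Finsupp.single m 1) = (if n = -m then (n : ℂ) else 0) * 1
  rw [Heis.cocycle_single]
  simp

lemma mode_mode (μ : ℂ) (n m : ℤ) (v : Verma μ) :
    mode μ n (mode μ m v) = mode μ m (mode μ n v) + if n = -m then (n : ℂ) • v else 0 := by
  have h := congrArg (· • v) (inc_mul_sub (Heis.a n) (Heis.a m))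
  simp only [sub_smul, inc_a_lie, mul_smul] at h
  rw [← algebraMap_smul UH, smul_assoc, K_smul] at h
  rw [mode_apply, mode_apply, mode_apply, mode_apply, eq_add_of_sub_eq' h]
  split_ifs with e
  · rw [algebraMap_smul]
  · simp

lemma mode_comm (μ : ℂ) {n m : ℤ} (h : n ≠ -m) (v : Verma μ) :
    mode μ n (mode μ m v) = mode μ m (mode μ n v) := by
  rw [mode_mode, if_neg h, add_zero]

lemma mode_comm_neg (μ : ℂ) {n m : ℤ} (hn : n < 0) (hm : m < 0) (v : Verma μ) :
    mode μ n (mode μ m v) = mode μ m (mode μ n v) := mode_comm μ (by omega) v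

lemma mode_comm_nonneg (μ : ℂ) {n m : ℤ} (hn : 0 ≤ n) (hm : 0 ≤ m) (v : Verma μ) :
    mode μ n (mode μ m v) = mode μ m (mode μ n v) := by
  rw [mode_mode]
  split_ifs with h
  · obtain rfl : n = 0 := by omega
    simp
  · rw [add_zero]

/-! ### Comparison with the polynomial algebra -/

lemma polyMode_neg (μ : ℂ) (j : ℕ+) (p : Poly) :
    polyMode μ (-((j : ℕ) : ℤ)) p = MvPolynomial.X j * p := by
  obtain ⟨k, rfl⟩ : ∃ k : ℕ, j = k.succPNat := ⟨j.natPred, by simp⟩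
  rfl

lemma polyMode_pos (μ : ℂ) (j : ℕ+) (p : Poly) :
    polyMode μ ((j : ℕ) : ℤ) p = ((j : ℕ) : ℂ) • MvPolynomial.pderiv j p := by
  obtain ⟨k, rfl⟩ : ∃ k : ℕ, j = k.succPNat := ⟨j.natPred, by simp⟩
  change ((k : ℂ) + 1) • MvPolynomial.pderiv k.succPNat p = _
  rw [Nat.succPNat_coe, Nat.succ_eq_add_one]
  push_cast
  rfl

lemma symbol_mk (μ : ℂ) (u : UH) :
    symbol μ (Submodule.Quotient.mk u) =
      UniversalEnvelopingAlgebra.lift ℂ (polyRep μ) u 1 := rfl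

lemma symbol_hw (μ : ℂ) : symbol μ (hw μ) = 1 := by
  rw [hw, symbol_mk, map_one (UniversalEnvelopingAlgebra.lift ℂ (polyRep μ)),
    Module.End.one_apply]

lemma symbol_mode (μ : ℂ) (n : ℤ) (v : Verma μ) :
    symbol μ (mode μ n v) = polyMode μ n (symbol μ v) := by
  obtain ⟨u, rfl⟩ := Submodule.Quotient.mk_surjective _ v
  rw [mode_apply, ← Submodule.Quotient.mk_smul, symbol_mk, symbol_mk, smul_eq_mul, map_mul,
    lift_inc, polyRep_a, Module.End.mul_apply]

/-- The creation operators of `M(μ)`. -/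
def creation (μ : ℂ) (j : ℕ+) : Module.End ℂ (Verma μ) := mode μ (-((j : ℕ) : ℤ))

lemma creation_comm (μ : ℂ) : ∀ x ∈ Set.range (creation μ), ∀ y ∈ Set.range (creation μ),
    x * y = y * x := by
  rintro _ ⟨i, rfl⟩ _ ⟨j, rfl⟩
  refine LinearMap.ext fun v => mode_comm_neg μ ?_ ?_ v
  · have := i.pos; omega
  · have := j.pos; omega

open scoped IsMulCommutative in
/-- There is an action of `ℂ[x₁, x₂, …]` on `M(μ)` in which `x_j` acts as `a_{-j}`. -/
lemma exists_creationHom (μ : ℂ) : ∃ F : Poly →ₐ[ℂ] Module.End ℂ (Verma μ),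
    ∀ j, F (MvPolynomial.X j) = mode μ (-((j : ℕ) : ℤ)) := by
  -- `aeval` needs a commutative target; the creation operators commute, so the subalgebra they
  -- generate is one.
  have := Algebra.isMulCommutative_adjoin ℂ (creation_comm μ)
  let _ : CommRing (Algebra.adjoin ℂ (Set.range (creation μ))) := inferInstance
  refine ⟨(Algebra.adjoin ℂ (Set.range (creation μ))).val.comp (MvPolynomial.aeval fun j =>
    ⟨creation μ j, Algebra.subset_adjoin ⟨j, rfl⟩⟩), fun j => ?_⟩
  rw [AlgHom.comp_apply, MvPolynomial.aeval_X]
  rfl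

lemma list_prod_X (s : ℕ+ →₀ ℕ) :
    ((s.support.sort (· ≥ ·)).map fun j : ℕ+ => (MvPolynomial.X j : Poly) ^ s j).prod =
      MvPolynomial.monomial s 1 := by
  rw [MvPolynomial.monomial_eq, map_one, one_mul, Finsupp.prod, Finset.prod, ← Multiset.prod_coe,
    ← Multiset.map_coe, Finset.sort_eq]

/-- Evaluating an algebra homomorphism at `hw μ` gets rid of the ordered products in `monom`. -/
lemma exists_realize_eq (μ : ℂ) : ∃ F : Poly →ₐ[ℂ] Module.End ℂ (Verma μ),
    (∀ j, F (MvPolynomial.X j) = mode μ (-((j : ℕ) : ℤ))) ∧ ∀ p, realize μ p = F p (hw μ) := by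
  obtain ⟨F, hF⟩ := exists_creationHom μ
  refine ⟨F, hF, fun p => ?_⟩
  suffices h : realize μ = (LinearMap.applyₗ (hw μ)).comp F.toLinearMap from
    congrArg (fun f => f p) h
  refine (MvPolynomial.basisMonomials ℕ+ ℂ).ext fun s => ?_
  rw [realize, Module.Basis.constr_basis, LinearMap.comp_apply, MvPolynomial.coe_basisMonomials]
  beta_reduce
  rw [LinearMap.applyₗ_apply_apply, AlgHom.toLinearMap_apply, ← list_prod_X, map_list_prod,
    List.map_map, monom]
  congr 3
  funext j
  rw [Function.comp_apply, map_pow, hF]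

lemma realize_monomial (μ : ℂ) (s : ℕ+ →₀ ℕ) :
    realize μ (MvPolynomial.monomial s 1) = monom μ s := by
  exact (MvPolynomial.basisMonomials ℕ+ ℂ).constr_basis ℂ (monom μ) s

lemma realize_one (μ : ℂ) : realize μ 1 = hw μ := by
  obtain ⟨F, hF, h⟩ := exists_realize_eq μ
  rw [h, map_one, Module.End.one_apply]

lemma realize_X_mul (μ : ℂ) (j : ℕ+) (p : Poly) :
    realize μ (MvPolynomial.X j * p) = mode μ (-((j : ℕ) : ℤ)) (realize μ p) := by
  obtain ⟨F, hF, h⟩ := exists_realize_eq μ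
  rw [h, h, map_mul, hF, Module.End.mul_apply]

/-- An induction principle for linear statements about polynomials. -/
lemma poly_induction {P : Poly → Prop} (h1 : P 1) (hX : ∀ j p, P p → P (MvPolynomial.X j * p))
    (hadd : ∀ p q, P p → P q → P (p + q)) (hsmul : ∀ (c : ℂ) p, P p → P (c • p)) (p : Poly) :
    P p := by
  induction p using MvPolynomial.induction_on with
  | C c =>
    have := hsmul c 1 h1
    rwa [MvPolynomial.smul_eq_C_mul, mul_one] at this
  | add p q hp hq => exact hadd p q hp hq
  | mul_X p j hp => rw [mul_comm]; exact hX j p hp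

lemma symbol_realize (μ : ℂ) (p : Poly) : symbol μ (realize μ p) = p := by
  refine poly_induction (P := fun p => symbol μ (realize μ p) = p) ?_ (fun j p hp => ?_)
    (fun p q hp hq => ?_) (fun c p hp => ?_) p
  · rw [realize_one, symbol_hw]
  · rw [realize_X_mul, symbol_mode, hp, polyMode_neg]
  · rw [map_add, map_add, hp, hq]
  · rw [map_smul, map_smul, hp]

/-- Only the annihilation operators need an argument: on both sides they kill the generator and have
the same commutators with the creation operators. -/
lemma realize_polyMode (μ : ℂ) (n : ℤ) (p : Poly) :
    realize μ (polyMode μ n p) = mode μ n (realize μ p) := by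
  obtain h | rfl | h := lt_trichotomy n 0
  · obtain ⟨j, rfl⟩ : ∃ j : ℕ+, n = -((j : ℕ) : ℤ) :=
      ⟨⟨(-n).toNat, by omega⟩, by simp only [PNat.mk_coe]; omega⟩
    rw [polyMode_neg, realize_X_mul]
  · rw [mode_zero, ← map_smul]
    rfl
  · obtain ⟨j, rfl⟩ : ∃ j : ℕ+, n = ((j : ℕ) : ℤ) :=
      ⟨⟨n.toNat, by omega⟩, by simp only [PNat.mk_coe]; omega⟩
    refine poly_induction (P := fun p => realize μ (polyMode μ ((j : ℕ) : ℤ) p) =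
      mode μ ((j : ℕ) : ℤ) (realize μ p)) ?_
      (fun i p hp => ?_) (fun p q hp hq => ?_) (fun c p hp => ?_) p
    · rw [realize_one, mode_pos_hw μ h, polyMode_pos]
      simp
    · have hc := congrArg (fun f => f p) (polyMode_comm μ ((j : ℕ) : ℤ) (-((i : ℕ) : ℤ)))
      simp only [LinearMap.sub_apply, Module.End.mul_apply] at hc
      rw [← polyMode_neg μ, eq_add_of_sub_eq' hc, polyMode_neg, polyMode_neg, map_add,
        realize_X_mul, realize_X_mul, hp, mode_mode μ ((j : ℕ) : ℤ) (-((i : ℕ) : ℤ))]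
      congr 1
      split_ifs <;> simp
    · simp only [map_add, hp, hq]
    · simp only [map_smul, hp]

/-- Both maps intertwine the actions of the Heisenberg algebra, and the Verma module is cyclic on
`hw μ`. With `symbol_realize` this gives the PBW basis. -/
lemma realize_symbol (μ : ℂ) (v : Verma μ) : realize μ (symbol μ v) = v := by
  have key : ∀ (u : UH) (v : Verma μ), realize μ (symbol μ v) = v →
      realize μ (symbol μ (u • v)) = u • v := by
    intro u
    refine UH_induction (P := fun u => ∀ v : Verma μ, realize μ (symbol μ v) = v →
      realize μ (symbol μ (u • v)) = u • v) (fun c v hv => ?_) (fun x v hv => ?_)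
      (fun u w hu hw v hv => ?_) (fun u w hu hw v hv => ?_) u
    · rw [algebraMap_smul, map_smul, map_smul, hv]
    · refine Heis_induction (P := fun x => realize μ (symbol μ (inc x • v)) = inc x • v)
        (fun n => ?_) ?_ (fun x y hx hy => ?_) (fun c x hx => ?_) x
      · rw [← mode_apply, symbol_mode, realize_polyMode, hv]
      · rw [K_smul, hv]
      · rw [map_add, add_smul, map_add, map_add, hx, hy]
      · rw [map_smul inc, smul_assoc, map_smul, map_smul, hx]
    · rw [mul_smul]
      exact hu _ (hw _ hv)
    · rw [add_smul, map_add, map_add, hu _ hv, hw _ hv]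
  obtain ⟨u, rfl⟩ := Submodule.Quotient.mk_surjective _ v
  rw [mk_eq_smul_hw]
  exact key u _ (by rw [symbol_hw, realize_one])

/-- The identification of `M(μ)` with `ℂ[x₁, x₂, …]`. -/
def symbolEquiv (μ : ℂ) : Verma μ ≃ₗ[ℂ] Poly :=
  LinearEquiv.ofLinearMap (symbol μ) (realize μ) (LinearMap.ext (symbol_realize μ))
    (LinearMap.ext (realize_symbol μ))

/-- The monomial basis of `M(μ)`. -/
def monomBasis (μ : ℂ) : Module.Basis (ℕ+ →₀ ℕ) ℂ (Verma μ) :=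
  (MvPolynomial.basisMonomials ℕ+ ℂ).map (symbolEquiv μ).symm

lemma monomBasis_apply (μ : ℂ) (s : ℕ+ →₀ ℕ) : monomBasis μ s = monom μ s := by
  rw [monomBasis, Module.Basis.map_apply, MvPolynomial.coe_basisMonomials]
  exact realize_monomial μ s

lemma symbol_monom (μ : ℂ) (s : ℕ+ →₀ ℕ) :
    symbol μ (monom μ s) = MvPolynomial.monomial s 1 := by
  rw [← realize_monomial, symbol_realize]

/-- An induction principle for linear statements about `M(μ)`. -/
lemma verma_induction {μ : ℂ} {P : Verma μ → Prop} (h1 : P (hw μ))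
    (hX : ∀ (j : ℕ+) v, P v → P (mode μ (-((j : ℕ) : ℤ)) v))
    (hadd : ∀ p q, P p → P q → P (p + q)) (hsmul : ∀ (c : ℂ) p, P p → P (c • p)) (v : Verma μ) :
    P v := by
  rw [← realize_symbol μ v]
  refine poly_induction (P := fun p => P (realize μ p)) ?_ (fun j p hp => ?_)
    (fun p q hp hq => ?_) (fun c p hp => ?_) _
  · rwa [realize_one]
  · rw [realize_X_mul]
    exact hX _ _ hp
  · rw [map_add]
    exact hadd _ _ hp hq
  · rw [map_smul]
    exact hsmul _ _ hp

/-! ### Normally ordered products with the derivatives of `a(z)` -/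

open HVertexOperator

lemma finsum_comp_of_support_subset {α β M : Type*} [AddCommMonoid M] {e : α → β}
    (he : Function.Injective e) {G : β → M} (hG : ∀ b ∉ Set.range e, G b = 0) :
    ∑ᶠ b, G b = ∑ᶠ i, G (e i) := by
  rw [← finsum_mem_range he, ← finsum_mem_univ]
  refine finsum_mem_inter_support_eq G _ _ ?_
  ext b
  simp only [Set.mem_inter_iff, Set.mem_univ, true_and, Function.mem_support]
  exact ⟨fun h => ⟨by_contra fun h' => h (hG b h'), h⟩, fun h => h.2⟩

lemma finsum_comm_of_finite {α β M : Type*} [AddCommMonoid M] {f : α → β → M}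
    (hf : (Function.support fun x : α × β => f x.1 x.2).Finite) :
    ∑ᶠ a, ∑ᶠ b, f a b = ∑ᶠ b, ∑ᶠ a, f a b := by
  rw [← finsum_curry (fun x : α × β => f x.1 x.2) hf,
    ← finsum_curry (fun x : β × α => f x.2 x.1),
    ← finsum_comp_equiv (Equiv.prodComm β α)]
  · rfl
  · refine (hf.image Prod.swap).subset fun x hx => ⟨x.swap, hx, Prod.swap_swap x⟩

/-- The coefficient of `a_m z^{-m-j}` in `∂^{(j-1)} a(z)`. -/
def modeCoeff (j : ℕ+) (m : ℤ) : ℤ := Ring.choose (-m - 1) ((j : ℕ) - 1)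

/-- The upper index of the binomial coefficient is then a natural number smaller than the lower one.
These are the modes for which the sign of the power of $z$ and the sign of the mode disagree. -/
lemma modeCoeff_eq_zero {j : ℕ+} {m : ℤ} (h : -((j : ℕ) : ℤ) < m) (hm : m < 0) :
    modeCoeff j m = 0 := by
  obtain ⟨k, hk⟩ : ∃ k : ℕ, -m - 1 = (k : ℤ) := ⟨(-m - 1).toNat, by omega⟩
  rw [modeCoeff, hk, Ring.choose_natCast, Nat.choose_eq_zero_of_lt (by omega), Nat.cast_zero]

lemma coeff_aField (μ : ℂ) (k : ℤ) : coeff (aField μ) k = mode μ (-k - 1) := rfl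

lemma coeff_dderiv_aField (μ : ℂ) (j : ℕ+) (k : ℤ) :
    coeff (dderiv ((j : ℕ) - 1) (aField μ)) k =
      modeCoeff j (-k - (j : ℕ)) • mode μ (-k - (j : ℕ)) := by
  change Ring.choose (k + ((j : ℕ) - 1 : ℕ)) ((j : ℕ) - 1) • mode μ (-(k + ((j : ℕ) - 1 : ℕ)) - 1) = _
  have hj := j.pos
  rw [modeCoeff, show k + ((j : ℕ) - 1 : ℕ) = -(-k - ((j : ℕ) : ℤ)) - 1 by omega,
    show -(-(-k - ((j : ℕ) : ℤ)) - 1) - 1 = -k - ((j : ℕ) : ℤ) by omega]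

/-- The normally ordered product of `a_m` with an operator: `a_m` is put on the left if it is a
creation operator and on the right otherwise. -/
def normalMode (μ : ℂ) (m : ℤ) : Module.End ℂ (Verma μ) →ₗ[ℂ] Module.End ℂ (Verma μ) :=
  if m < 0 then LinearMap.mulLeft ℂ (mode μ m) else LinearMap.mulRight ℂ (mode μ m)

lemma normalMode_neg {μ : ℂ} {m : ℤ} (h : m < 0) (X : Module.End ℂ (Verma μ)) (v : Verma μ) :
    normalMode μ m X v = mode μ m (X v) := by
  rw [normalMode, if_pos h]
  rfl

lemma normalMode_nonneg {μ : ℂ} {m : ℤ} (h : 0 ≤ m) (X : Module.End ℂ (Verma μ)) (v : Verma μ) :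
    normalMode μ m X v = X (mode μ m v) := by
  rw [normalMode, if_neg (not_lt.mpr h)]
  rfl

/-- Two modes on the same side of `X` are both creation operators or both non-negative modes, and so
commute; on different sides there is nothing to prove. -/
lemma normalMode_comm (μ : ℂ) (m n : ℤ) (X : Module.End ℂ (Verma μ)) :
    normalMode μ m (normalMode μ n X) = normalMode μ n (normalMode μ m X) := by
  refine LinearMap.ext fun v => ?_
  by_cases hm : m < 0 <;> by_cases hn : n < 0
  · simp only [normalMode_neg hm, normalMode_neg hn, mode_comm_neg μ hm hn]
  · simp only [normalMode_neg hm, normalMode_nonneg (not_lt.mp hn)]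
  · simp only [normalMode_neg hn, normalMode_nonneg (not_lt.mp hm)]
  · simp only [normalMode_nonneg (not_lt.mp hm), normalMode_nonneg (not_lt.mp hn),
      mode_comm_nonneg μ (not_lt.mp hm) (not_lt.mp hn)]

lemma normalMode_finite (μ : ℂ) (C : VertexOperator ℂ (Verma μ)) (n : ℤ) (v : Verma μ) :
    (Function.support fun m : ℤ => normalMode μ m (coeff C (n + m)) v).Finite := by
  obtain ⟨N, hN⟩ := exists_coeff_eq_zero C v
  obtain ⟨B, hB⟩ := mode_bounded μ v
  refine (Set.finite_Icc (min 0 (N - n)) (max 0 B)).subset fun m hm => ?_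
  rw [Function.mem_support] at hm
  by_cases h : m < 0
  · rw [normalMode_neg h] at hm
    have : ¬ n + m < N := fun h' => hm (by rw [hN _ h', map_zero])
    rw [Set.mem_Icc]
    omega
  · rw [normalMode_nonneg (not_lt.mp h)] at hm
    have : ¬ m > B := fun h' => hm (by rw [hB _ h', map_zero])
    rw [Set.mem_Icc]
    omega

/-- Non-negative modes acting on `v` first bound the indices above; once these are bounded,
truncation of `C` on finitely many vectors bounds the indices below. -/
lemma normalMode_normalMode_finite (μ : ℂ) (C : VertexOperator ℂ (Verma μ)) (n : ℤ)
    (v : Verma μ) : (Function.support fun x : ℤ × ℤ =>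
      normalMode μ x.1 (normalMode μ x.2 (coeff C (n + x.1 + x.2))) v).Finite := by
  obtain ⟨N, hN⟩ := exists_coeff_eq_zero C v
  obtain ⟨B, hB⟩ := mode_bounded μ v
  choose Q hQ using fun m : ℤ => exists_coeff_eq_zero C (mode μ m v)
  obtain ⟨R, hR⟩ := ((Finset.Icc 0 B).image Q).bddBelow
  have hR' : ∀ m, 0 ≤ m → m ≤ B → R ≤ Q m := fun m h0 h1 =>
    hR (by exact_mod_cast Finset.mem_image_of_mem Q (Finset.mem_Icc.mpr ⟨h0, h1⟩))
  have key : ∀ m m' : ℤ, normalMode μ m (normalMode μ m' (coeff C (n + m + m'))) v ≠ 0 →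
      min (min 0 (N - n)) (R - n - max 0 B) ≤ m' ∧ m ≤ max 0 B := by
    intro m m' h
    by_cases hm : m < 0 <;> by_cases hm' : m' < 0
    · rw [normalMode_neg hm, normalMode_neg hm'] at h
      have : ¬ n + m + m' < N := fun h' => h (by rw [hN _ h', map_zero, map_zero])
      omega
    · omega
    · rw [normalMode_nonneg (not_lt.mp hm), normalMode_neg hm'] at h
      have h1 : ¬ m > B := fun h' => h (by rw [hB _ h', map_zero, map_zero])
      have h2 := hR' m (by omega) (by omega)
      have : ¬ n + m + m' < Q m := fun h' => h (by rw [hQ _ _ h', map_zero])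
      omega
    · rw [normalMode_nonneg (not_lt.mp hm), normalMode_nonneg (not_lt.mp hm')] at h
      have h1 : ¬ m > B := fun h' => h (by rw [hB _ h', map_zero, map_zero])
      omega
  refine ((Set.finite_Icc (min (min 0 (N - n)) (R - n - max 0 B)) (max 0 B)).prod
    (Set.finite_Icc (min (min 0 (N - n)) (R - n - max 0 B)) (max 0 B))).subset fun x hx => ?_
  have h1 := key x.1 x.2 hx
  -- `key` bounds one index below and the other above; the symmetry of the expression gives the two
  -- remaining bounds.
  have h2 := key x.2 x.1 (by rwa [normalMode_comm, add_right_comm])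
  exact ⟨⟨h2.1, h1.2⟩, ⟨h1.1, h2.2⟩⟩

lemma smul_normalMode_finite (μ : ℂ) (c : ℤ → ℤ) (C : VertexOperator ℂ (Verma μ)) (n k : ℤ)
    (v : Verma μ) :
    (Function.support fun m : ℤ => c m • normalMode μ m (coeff C (n + m + k)) v).Finite := by
  refine (normalMode_finite μ C (n + k) v).subset fun m hm => ?_
  rw [Function.mem_support] at hm ⊢
  rw [add_right_comm]
  exact fun h => hm (by rw [h, smul_zero])

lemma coeff_nprod (μ : ℂ) (A B : VertexOperator ℂ (Verma μ)) (n : ℤ) (v : Verma μ) :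
    coeff (nprod A B) n v = (∑ᶠ i : ℕ, coeff A (i : ℤ) (coeff B (n - i) v)) +
      ∑ᶠ i : ℕ, coeff B (n + i + 1) (coeff A (-(i : ℤ) - 1) v) := rfl

/-- `nprod` splits by the sign of the power $z^{-m-j}$, `normalMode` by the sign of $m$. They differ
only for $-j<m<0$, where the coefficient vanishes. -/
lemma coeff_nprod_dderiv (μ : ℂ) (j : ℕ+) (C : VertexOperator ℂ (Verma μ)) (n : ℤ)
    (v : Verma μ) :
    coeff (nprod (dderiv ((j : ℕ) - 1) (aField μ)) C) n v =
      ∑ᶠ m : ℤ, modeCoeff j m • normalMode μ m (coeff C (n + m + (j : ℕ))) v := by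
  have hj := j.pos
  rw [coeff_nprod]
  set G : ℤ → Verma μ :=
    fun m => modeCoeff j m • normalMode μ m (coeff C (n + m + (j : ℕ))) v with hG
  have hfin : (Function.support G).Finite := smul_normalMode_finite μ _ C n _ v
  have hsplit : ∀ m, G m = (if m < 0 then G m else 0) + (if m < 0 then 0 else G m) := fun m => by
    split_ifs <;> simp
  rw [finsum_congr hsplit, finsum_add_distrib
    (hfin.subset fun m hm => fun h => hm (by simp only [h, ite_self]))
    (hfin.subset fun m hm => fun h => hm (by simp only [h, ite_self]))]
  congr 1
  -- The power $z^i$ carries the mode $-i-j$; the remaining negative modes have coefficient zero.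
  · rw [finsum_comp_of_support_subset (e := fun i : ℕ => -(i : ℤ) - (j : ℕ))]
    · refine finsum_congr fun i => ?_
      rw [if_pos (by omega), hG, coeff_dderiv_aField]
      beta_reduce
      rw [normalMode_neg (by omega), LinearMap.smul_apply,
        show n + (-(i : ℤ) - (j : ℕ)) + (j : ℕ) = n - i by ring]
    · intro a b h
      simpa using h
    · intro m hm
      split_ifs with h0
      · rw [hG]
        beta_reduce
        rw [modeCoeff_eq_zero _ h0, zero_smul]
        by_contra h
        exact hm ⟨(-m - (j : ℕ)).toNat, by beta_reduce; omega⟩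
      · rfl
  -- The power $z^{-i-1}$ carries the mode $i+1-j$; when this is negative, its coefficient is zero.
  · rw [finsum_comp_of_support_subset (e := fun i : ℕ => (i : ℤ) + 1 - (j : ℕ))]
    · refine finsum_congr fun i => ?_
      rw [coeff_dderiv_aField, show -(-(i : ℤ) - 1) - ((j : ℕ) : ℤ) = (i : ℤ) + 1 - (j : ℕ) by ring]
      split_ifs with h
      · rw [modeCoeff_eq_zero (by omega) h, zero_smul, LinearMap.zero_apply, map_zero]
      · rw [hG]
        beta_reduce
        rw [normalMode_nonneg (by omega), LinearMap.smul_apply, map_zsmul,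
          show n + ((i : ℤ) + 1 - (j : ℕ)) + (j : ℕ) = n + i + 1 by ring]
    · intro a b h
      simpa using h
    · intro m hm
      rw [if_pos]
      by_contra h
      exact hm ⟨(m - 1 + (j : ℕ)).toNat, by beta_reduce; omega⟩

/-- The operator `C(z) ↦ :∂^{(j-1)}a(z) C(z):` on fields. -/
def nprodLin (μ : ℂ) (j : ℕ+) : VertexOperator ℂ (Verma μ) →ₗ[ℂ] VertexOperator ℂ (Verma μ) where
  toFun C := nprod (dderiv ((j : ℕ) - 1) (aField μ)) C
  map_add' C D := by
    refine coeff_inj (funext fun n => LinearMap.ext fun v => ?_)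
    rw [map_add, Pi.add_apply, LinearMap.add_apply, coeff_nprod_dderiv, coeff_nprod_dderiv,
      coeff_nprod_dderiv, ← finsum_add_distrib (smul_normalMode_finite μ _ C n _ v)
        (smul_normalMode_finite μ _ D n _ v)]
    refine finsum_congr fun m => ?_
    rw [map_add, Pi.add_apply, map_add, LinearMap.add_apply, smul_add]
  map_smul' c C := by
    refine coeff_inj (funext fun n => LinearMap.ext fun v => ?_)
    rw [RingHom.id_apply, map_smul, Pi.smul_apply, LinearMap.smul_apply, coeff_nprod_dderiv,
      coeff_nprod_dderiv, smul_finsum' _ (smul_normalMode_finite μ _ C n _ v)]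
    refine finsum_congr fun m => ?_
    rw [map_smul, Pi.smul_apply, map_smul, LinearMap.smul_apply, smul_comm]

lemma coeff_nprodLin (μ : ℂ) (j : ℕ+) (C : VertexOperator ℂ (Verma μ)) (n : ℤ)
    (v : Verma μ) : coeff (nprodLin μ j C) n v =
      ∑ᶠ m : ℤ, modeCoeff j m • normalMode μ m (coeff C (n + m + (j : ℕ))) v :=
  coeff_nprod_dderiv μ j C n v

lemma normalMode_coeff_nprodLin (μ : ℂ) (j : ℕ+) (C : VertexOperator ℂ (Verma μ)) (l m : ℤ)
    (v : Verma μ) : normalMode μ m (coeff (nprodLin μ j C) l) v =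
      ∑ᶠ m' : ℤ, modeCoeff j m' •
        normalMode μ m (normalMode μ m' (coeff C (l + m' + (j : ℕ)))) v := by
  by_cases h : m < 0
  · simp only [normalMode_neg h, coeff_nprodLin]
    rw [map_finsum _ (smul_normalMode_finite μ _ C l _ v)]
    simp only [map_zsmul]
  · simp only [normalMode_nonneg (not_lt.mp h), coeff_nprodLin]

/-- Both sides are double sums over pairs of modes, and `normalMode_comm` identifies them after the
order of summation is exchanged. Hence the sorting in the definition of `Y` is immaterial. -/
lemma nprodLin_comm (μ : ℂ) (i j : ℕ+) (C : VertexOperator ℂ (Verma μ)) :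
    nprodLin μ i (nprodLin μ j C) = nprodLin μ j (nprodLin μ i C) := by
  have key : ∀ (i j : ℕ+) (n : ℤ) (v : Verma μ), coeff (nprodLin μ i (nprodLin μ j C)) n v =
      ∑ᶠ m : ℤ, ∑ᶠ m' : ℤ, (modeCoeff i m * modeCoeff j m') •
        normalMode μ m (normalMode μ m' (coeff C (n + (i : ℕ) + (j : ℕ) + m + m'))) v := by
    intro i j n v
    rw [coeff_nprodLin]
    refine finsum_congr fun m => ?_
    have hfin := (normalMode_normalMode_finite μ C (n + (i : ℕ) + (j : ℕ)) v).preimage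
      (f := fun m' => (m, m')) (fun a _ b _ h => (Prod.mk.inj h).2)
    rw [normalMode_coeff_nprodLin, smul_finsum' _ (hfin.subset fun m' hm' h => hm' ?_)]
    swap
    · dsimp only at h ⊢
      rw [show n + m + (i : ℕ) + m' + (j : ℕ) = n + (i : ℕ) + (j : ℕ) + m + m' by ring, h,
        smul_zero]
    refine finsum_congr fun m' => ?_
    rw [smul_smul, show n + m + (i : ℕ) + m' + (j : ℕ) = n + (i : ℕ) + (j : ℕ) + m + m' by ring]
  refine coeff_inj (funext fun n => LinearMap.ext fun v => ?_)
  rw [key, key, finsum_comm_of_finite]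
  · refine finsum_congr fun m => finsum_congr fun m' => ?_
    rw [normalMode_comm, mul_comm]
    congr 5
    ring_nf
  · refine (normalMode_normalMode_finite μ C (n + (i : ℕ) + (j : ℕ)) v).subset fun x hx => ?_
    rw [Function.mem_support] at hx ⊢
    exact fun h => hx (by rw [h, smul_zero])

/-- The field `Y^μ(p, z)`, as a function of the polynomial that corresponds to a state. -/
def polyField (μ : ℂ) : Poly →ₗ[ℂ] VertexOperator ℂ (Verma μ) := (Y μ).comp (realize 0)

lemma Y_eq_polyField (μ : ℂ) (b : V) : Y μ b = polyField μ (symbol 0 b) := by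
  rw [polyField, LinearMap.comp_apply, realize_symbol]

lemma polyField_monomial (μ : ℂ) (s : ℕ+ →₀ ℕ) :
    polyField μ (MvPolynomial.monomial s 1) =
      (s.toMultiset.sort (· ≥ ·)).foldr (fun j => nprodLin μ j) idField := by
  rw [polyField, LinearMap.comp_apply, Y, LinearMap.comp_apply, symbol_realize]
  refine ((MvPolynomial.basisMonomials ℕ+ ℂ).constr_basis ℂ _ s).trans ?_
  rw [List.foldr_map]
  rfl

lemma polyField_one (μ : ℂ) : polyField μ 1 = idField := by
  have h := polyField_monomial μ 0
  rw [map_zero, Multiset.sort_zero] at h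
  exact h

/-- A new factor may land anywhere in the sorted list, but the fold is invariant under permutations
by `nprodLin_comm`. -/
lemma polyField_X_mul (μ : ℂ) (j : ℕ+) (p : Poly) :
    polyField μ (MvPolynomial.X j * p) = nprodLin μ j (polyField μ p) := by
  suffices h : (polyField μ).comp (LinearMap.mulLeft ℂ (MvPolynomial.X j)) =
      (nprodLin μ j).comp (polyField μ) from congrArg (fun f => f p) h
  refine (MvPolynomial.basisMonomials ℕ+ ℂ).ext fun s => ?_
  rw [MvPolynomial.coe_basisMonomials]
  simp only [LinearMap.comp_apply, LinearMap.mulLeft_apply]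
  rw [MvPolynomial.X, MvPolynomial.monomial_mul, one_mul, polyField_monomial, polyField_monomial]
  have hperm : ((Finsupp.single j 1 + s).toMultiset.sort (· ≥ ·)).Perm
      (j :: s.toMultiset.sort (· ≥ ·)) := by
    rw [← Multiset.coe_eq_coe, ← Multiset.cons_coe, Multiset.sort_eq, Multiset.sort_eq, map_add,
      Finsupp.toMultiset_single, one_smul, Multiset.singleton_add]
  exact hperm.foldr_eq' (fun x _ y _ z => nprodLin_comm μ y x z) _

lemma coeff_idField (μ : ℂ) (n : ℤ) (v : Verma μ) :
    coeff (idField : VertexOperator ℂ (Verma μ)) n v = if n = 0 then v else 0 := by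
  change (if n = 0 then (1 : Module.End ℂ (Verma μ)) else 0) v = _
  split_ifs <;> rfl

/-- The modes of the field of a product with `x_j`. -/
lemma coeff_polyField_X_mul (μ : ℂ) (j : ℕ+) (p : Poly) (n : ℤ) (v : Verma μ) :
    coeff (polyField μ (MvPolynomial.X j * p)) n v =
      ∑ᶠ m : ℤ, modeCoeff j m • normalMode μ m (coeff (polyField μ p) (n + m + (j : ℕ))) v := by
  rw [polyField_X_mul, coeff_nprodLin]

lemma coeff_polyField_X (μ : ℂ) (j : ℕ+) (n : ℤ) (v : Verma μ) :
    coeff (polyField μ (MvPolynomial.X j)) n v =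
      modeCoeff j (-n - (j : ℕ)) • mode μ (-n - (j : ℕ)) v := by
  rw [← mul_one (MvPolynomial.X j), coeff_polyField_X_mul, polyField_one,
    finsum_eq_single _ (-n - (j : ℕ) : ℤ)]
  · congr 1
    by_cases h : -n - ((j : ℕ) : ℤ) < 0
    · rw [normalMode_neg h, coeff_idField, if_pos (by ring)]
    · rw [normalMode_nonneg (not_lt.mp h), coeff_idField, if_pos (by ring)]
  · intro m hm
    have h0 : n + m + ((j : ℕ) : ℤ) ≠ 0 := by omega
    by_cases h : m < 0
    · rw [normalMode_neg h, coeff_idField, if_neg h0, map_zero, smul_zero]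
    · rw [normalMode_nonneg (not_lt.mp h), coeff_idField, if_neg h0, smul_zero]

/-! ### The Virasoro operators on `V` -/

lemma modeCoeff_one (m : ℤ) : modeCoeff 1 m = 1 := by
  rw [modeCoeff]
  exact Ring.choose_zero_right _

lemma modeCoeff_two (m : ℤ) : modeCoeff 2 m = -m - 1 := by
  rw [modeCoeff]
  exact Ring.choose_one_right _

lemma aState_eq : aState = realize 0 (MvPolynomial.X 1) := by
  rw [← mul_one (MvPolynomial.X 1), realize_X_mul, realize_one]
  rfl

lemma Ycoeff_realize (μ : ℂ) (p : Poly) (n : ℤ) :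
    Ycoeff μ (realize 0 p) n = coeff (polyField μ p) n := rfl

lemma T_aState : T aState = realize 0 (MvPolynomial.X 2) := by
  rw [T, aState_eq, Ycoeff_realize, coeff_polyField_X, modeCoeff_one, one_smul,
    ← mul_one (MvPolynomial.X 2), realize_X_mul, realize_one]
  rfl

lemma stateProd_aState :
    stateProd aState aState = realize 0 (MvPolynomial.X 1 * MvPolynomial.X 1) := by
  rw [stateProd, aState_eq, Ycoeff_realize, coeff_polyField_X, modeCoeff_one, one_smul,
    realize_X_mul]
  rfl

lemma L_eq (t : ℂ) : L t = realize 0 ((1 / 2 : ℂ) • (MvPolynomial.X 1 * MvPolynomial.X 1) +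
    t • MvPolynomial.X 2) := by
  rw [L, stateProd_aState, T_aState, map_add, map_smul, map_smul]

lemma normalMode_mode_finite (μ : ℂ) (n : ℤ) (v : Verma μ) :
    (Function.support fun m : ℤ => normalMode μ m (mode μ (n - m)) v).Finite := by
  refine (normalMode_finite μ (aField μ) (-n - 1) v).subset fun m hm => ?_
  rw [Function.mem_support] at hm ⊢
  rwa [coeff_aField, show -(-n - 1 + m) - 1 = n - m by ring]

/-- The factor $-t(n+1)$ is the coefficient of $a_nz^{-n-2}$ in $t\,\partial a(z)$. -/
lemma Lmode_apply (t : ℂ) (n : ℤ) (v : V) :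
    Lmode t n v = (1 / 2 : ℂ) • ∑ᶠ m : ℤ, normalMode 0 m (mode 0 (n - m)) v +
      (-t * (n + 1)) • mode 0 n v := by
  rw [Lmode, L_eq, Ycoeff_realize, map_add, map_smul, map_smul, map_add, map_smul, map_smul,
    Pi.add_apply, Pi.smul_apply, Pi.smul_apply, LinearMap.add_apply, LinearMap.smul_apply,
    LinearMap.smul_apply, coeff_polyField_X, coeff_polyField_X_mul, modeCoeff_two]
  congr 1
  · congr 1
    refine finsum_congr fun m => ?_
    rw [modeCoeff_one, one_smul]
    congr 2
    refine LinearMap.ext fun w => ?_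
    rw [coeff_polyField_X, modeCoeff_one, one_smul]
    congr 2
    simp
    ring
  · rw [show -(-n - 2) - (((2 : ℕ+) : ℕ) : ℤ) = n by
      change -(-n - 2) - 2 = n
      ring, ← Int.cast_smul_eq_zsmul ℂ, smul_smul]
    congr 1
    push_cast
    ring

lemma Lmode_hw (t : ℂ) {n : ℤ} (hn : 0 ≤ n) : Lmode t n (hw 0) = 0 := by
  have h0 : ∀ k : ℤ, 0 ≤ k → mode 0 k (hw 0) = 0 := fun k hk => by
    obtain rfl | hk := hk.eq_or_lt
    · rw [mode_zero, zero_smul]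
    · exact mode_pos_hw 0 hk
  rw [Lmode_apply, h0 n hn, smul_zero, add_zero, finsum_eq_zero_of_forall_eq_zero, smul_zero]
  intro m
  by_cases hm : m < 0
  · rw [normalMode_neg hm, h0 _ (by omega), map_zero]
  · rw [normalMode_nonneg (not_lt.mp hm), h0 _ (by omega), map_zero]

/-- Moving $a_{-j}$ to the left past both factors produces one contraction with each: with $a_{n-m}$
when $m=n-j$, with $a_m$ when $m=j$. -/
lemma normalMode_mode_mode (μ : ℂ) (n j m : ℤ) (v : Verma μ) :
    normalMode μ m (mode μ (n - m)) (mode μ (-j) v) =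
      mode μ (-j) (normalMode μ m (mode μ (n - m)) v) +
        ((if m = n - j then (j : ℂ) • mode μ (n - j) v else 0) +
          if m = j then (j : ℂ) • mode μ (n - j) v else 0) := by
  have h1 : (if n - m = - -j then ((n - m : ℤ) : ℂ) • v else 0) =
      if m = n - j then (j : ℂ) • v else 0 := by
    by_cases h : m = n - j
    · rw [if_pos h, if_pos (by omega), h, sub_sub_cancel]
    · rw [if_neg h, if_neg (by omega)]
  have h2 : ∀ w : Verma μ, (if m = - -j then (m : ℂ) • w else 0) = if m = j then (j : ℂ) • w else 0 := by
    intro w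
    rw [neg_neg]
    by_cases h : m = j
    · rw [if_pos h, if_pos h, h]
    · rw [if_neg h, if_neg h]
  by_cases hm : m < 0
  · rw [normalMode_neg hm, normalMode_neg hm, mode_mode μ (n - m) (-j), h1, map_add,
      mode_mode μ m (-j), h2, add_assoc, add_comm (if m = j then _ else _)]
    congr 2
    · split_ifs with h
      · rw [map_smul, h]
      · rw [map_zero]
    · split_ifs with h
      · rw [h]
      · rfl
  · rw [normalMode_nonneg (not_lt.mp hm), normalMode_nonneg (not_lt.mp hm), mode_mode μ m (-j),
      h2, map_add, mode_mode μ (n - m) (-j), add_assoc]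
    congr 2
    · split_ifs with h h' h'
      · rw [sub_eq_iff_eq_add] at h
        rw [h', sub_sub_cancel]
      · exact absurd (by omega) h'
      · exact absurd (by omega) h
      · rfl
    · split_ifs with h
      · rw [map_smul, h]
      · rw [map_zero]

lemma finsum_if_eq {M : Type*} [AddCommMonoid M] (a : ℤ) (x : M) :
    ∑ᶠ m : ℤ, (if m = a then x else 0) = x := by
  rw [finsum_eq_single _ a (fun m hm => if_neg hm), if_pos rfl]

lemma if_eq_finite {M : Type*} [AddCommMonoid M] (a : ℤ) (x : M) :
    (Function.support fun m : ℤ => if m = a then x else 0).Finite :=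
  (Set.finite_singleton a).subset fun m hm => by
    by_contra h
    exact hm (if_neg h)

/-- The two contractions each contribute $j\,a_{n-j}$, which cancels the factor $1/2$; the last term
comes from commuting $-t(n+1)a_n$ with $a_{-j}$. -/
lemma Lmode_mode_neg (t : ℂ) (n j : ℤ) (v : V) :
    Lmode t n (mode 0 (-j) v) = mode 0 (-j) (Lmode t n v) + (j : ℂ) • mode 0 (n - j) v +
      if n = j then (-t * (n + 1) * n) • v else 0 := by
  rw [Lmode_apply, Lmode_apply, finsum_congr fun m => normalMode_mode_mode 0 n j m v,
    finsum_add_distrib, finsum_add_distrib (if_eq_finite _ _) (if_eq_finite _ _), finsum_if_eq,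
    finsum_if_eq, ← map_finsum _ (normalMode_mode_finite 0 n v), mode_mode 0 n (-j), neg_neg,
    map_add, map_smul, map_smul]
  · have : (if n = j then (-t * (n + 1) * n) • v else 0) =
        (-t * (n + 1)) • (if n = j then (n : ℂ) • v else 0) := by
      split_ifs
      · rw [smul_smul]
      · rw [smul_zero]
    rw [this]
    module
  · refine (normalMode_mode_finite 0 n v).subset fun m hm h => hm ?_
    dsimp only at h ⊢
    rw [h, map_zero]
  · refine ((if_eq_finite (n - j) ((j : ℂ) • mode 0 (n - j) v)).union
      (if_eq_finite j ((j : ℂ) • mode 0 (n - j) v))).subset (Function.support_add _ _)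

/-! ### The operators $L(t)_0$ and $L(t)_1$ on polynomials -/

/-- The operator `L(t)_n` on polynomials. -/
def polyL (t : ℂ) (n : ℤ) : Module.End ℂ Poly := symbol 0 ∘ₗ Lmode t n ∘ₗ realize 0

lemma polyL_apply (t : ℂ) (n : ℤ) (p : Poly) :
    polyL t n p = symbol 0 (Lmode t n (realize 0 p)) := rfl

lemma polyL_one (t : ℂ) {n : ℤ} (hn : 0 ≤ n) : polyL t n 1 = 0 := by
  rw [polyL_apply, realize_one, Lmode_hw t hn, map_zero]

lemma polyL_X_mul (t : ℂ) (n : ℤ) (j : ℕ+) (p : Poly) :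
    polyL t n (MvPolynomial.X j * p) = MvPolynomial.X j * polyL t n p +
      ((j : ℕ) : ℂ) • polyMode 0 (n - (j : ℕ)) p +
      if n = (j : ℕ) then (-t * (n + 1) * n) • p else 0 := by
  rw [polyL_apply, realize_X_mul, Lmode_mode_neg, map_add, map_add, symbol_mode, polyMode_neg,
    map_smul, symbol_mode, symbol_realize, polyL_apply]
  congr 1
  split_ifs
  · rw [map_smul, symbol_realize]
  · rw [map_zero]

lemma monomial_single_add (j : ℕ+) (s : ℕ+ →₀ ℕ) :
    (MvPolynomial.monomial (Finsupp.single j 1 + s) 1 : Poly) =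
      MvPolynomial.X j * MvPolynomial.monomial s 1 := by
  rw [MvPolynomial.X, MvPolynomial.monomial_mul, one_mul]

lemma exponent_induction {P : (ℕ+ →₀ ℕ) → Prop} (h0 : P 0)
    (h : ∀ j s, P s → P (Finsupp.single j 1 + s)) (s : ℕ+ →₀ ℕ) : P s := by
  rw [← Finsupp.toMultiset_toFinsupp s]
  induction s.toMultiset using Multiset.induction with
  | empty => rwa [map_zero]
  | cons j m hm =>
    rw [← Multiset.singleton_add, map_add, Multiset.toFinsupp_singleton]
    exact h j _ hm

/-- The conformal weight of a monomial. -/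
def monomWeight (s : ℕ+ →₀ ℕ) : ℕ := s.sum fun j i => i * (j : ℕ)

lemma monomWeight_single_add (j : ℕ+) (s : ℕ+ →₀ ℕ) :
    monomWeight (Finsupp.single j 1 + s) = j + monomWeight s := by
  rw [monomWeight, Finsupp.sum_add_index' (fun _ => zero_mul _) (fun _ _ _ => add_mul _ _ _),
    Finsupp.sum_single_index (zero_mul _), one_mul]
  rfl

lemma polyL_zero_monomial (t : ℂ) (s : ℕ+ →₀ ℕ) :
    polyL t 0 (MvPolynomial.monomial s 1) = (monomWeight s : ℂ) • MvPolynomial.monomial s 1 := by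
  refine exponent_induction (P := fun s => polyL t 0 (MvPolynomial.monomial s 1) =
    (monomWeight s : ℂ) • MvPolynomial.monomial s 1) ?_ (fun j s hs => ?_) s
  · have h : monomWeight 0 = 0 := rfl
    rw [h, Nat.cast_zero, zero_smul]
    exact polyL_one t le_rfl
  · have hj := j.pos
    rw [monomial_single_add, polyL_X_mul, hs, zero_sub, polyMode_neg, if_neg (by omega), add_zero,
      mul_smul_comm, monomWeight_single_add, ← add_smul, Nat.cast_add, add_comm]

/-- $L(t)_0$ is diagonal on monomials; consequently an eigenvector involves only monomials of its
own weight. -/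
lemma coeff_polyL_zero (t : ℂ) (s : ℕ+ →₀ ℕ) (p : Poly) :
    MvPolynomial.coeff s (polyL t 0 p) = monomWeight s * MvPolynomial.coeff s p := by
  suffices h : (MvPolynomial.lcoeff ℂ s).comp (polyL t 0) =
      (monomWeight s : ℂ) • MvPolynomial.lcoeff ℂ s from congrArg (fun f => f p) h
  refine (MvPolynomial.basisMonomials ℕ+ ℂ).ext fun s' => ?_
  rw [LinearMap.comp_apply, MvPolynomial.coe_basisMonomials]
  beta_reduce
  rw [polyL_zero_monomial, map_smul, LinearMap.smul_apply]
  simp only [MvPolynomial.lcoeff_apply]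
  rw [MvPolynomial.coeff_monomial]
  split_ifs with h
  · rw [h]
  · rw [smul_zero, smul_zero]

/-! ### The exponential of $L(t)_1$ -/

/-- The coefficient of `zᵃ` in `e^{z L(t)₁} x_j`. -/
def shiftVar (t : ℂ) (j : ℕ+) (a : ℕ) : Poly :=
  if a < j then ((j : ℕ).choose a : ℂ) • MvPolynomial.X (j - a - 1 : ℕ).succPNat
  else if a = j then MvPolynomial.C (-2 * t) else 0

/-- The commutator of $L(t)_1$ with multiplication by the $a$-th coefficient is $a+1$ times the next
one: the differential equation of $e^{zL(t)_1}x_j$. -/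
lemma polyL_one_shiftVar_mul (t : ℂ) (j : ℕ+) (a : ℕ) (q : Poly) :
    polyL t 1 (shiftVar t j a * q) =
      ((a : ℂ) + 1) • (shiftVar t j (a + 1) * q) + shiftVar t j a * polyL t 1 q := by
  rw [add_comm]
  obtain h | rfl | h := lt_trichotomy a j
  · rw [shiftVar, if_pos h, smul_mul_assoc, map_smul, polyL_X_mul, smul_mul_assoc, add_assoc,
      smul_add]
    congr 1
    -- Below the last variable, $x_{j-a}$ is lowered to $x_{j-a-1}$, and the constants agree by
    -- $\binom ja(j-a)=(a+1)\binom j{a+1}$.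
    obtain h1 | h1 : a + 1 < j ∨ a + 1 = j := by omega
    · have h2 : 1 - (((j - a - 1 : ℕ).succPNat : ℕ) : ℤ) =
          -(((j - (a + 1) - 1 : ℕ).succPNat : ℕ) : ℤ) := by
        simp only [Nat.succPNat_coe]
        omega
      rw [h2, polyMode_neg, if_neg (by simp only [Nat.succPNat_coe]; omega), add_zero, shiftVar,
        if_pos h1, smul_mul_assoc, smul_smul, smul_smul]
      congr 1
      have h3 := Nat.choose_succ_right_eq (j : ℕ) a
      have h6 : (j - a - 1).succPNat = (j : ℕ) - a := by
        rw [Nat.succPNat_coe]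
        omega
      rw [h6, mul_comm ((a : ℂ) + 1)]
      exact_mod_cast h3.symm
    -- The variable is now $x_1$: the commutator is $a_0-2t$, and $a_0$ is zero on $V$.
    · have h2 : (((j - a - 1 : ℕ).succPNat : ℕ) : ℤ) = 1 := by
        simp only [Nat.succPNat_coe]
        omega
      have h4 : (shiftVar t j (a + 1)) = MvPolynomial.C (-2 * t) := by
        rw [shiftVar, if_neg (by omega), if_pos h1]
      rw [h2, h4, ← MvPolynomial.smul_eq_C_mul, smul_smul, if_pos rfl]
      have h3 : (j : ℕ).choose a = a + 1 := by rw [← h1, Nat.choose_succ_self_right]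
      have h5 : polyMode 0 (1 - 1) q = 0 := by
        change (0 : ℂ) • q = 0
        rw [zero_smul]
      rw [h5, smul_zero, zero_add, smul_smul, h3]
      congr 1
      push_cast
      ring
  · have h4 : (shiftVar t j (j + 1)) = 0 := by
      rw [shiftVar, if_neg (by omega), if_neg (by omega)]
    rw [h4, shiftVar, if_neg (by omega), if_pos rfl, ← MvPolynomial.smul_eq_C_mul,
      ← MvPolynomial.smul_eq_C_mul, map_smul, zero_mul, smul_zero, add_zero]
  · have h4 : (shiftVar t j a) = 0 := by
      rw [shiftVar, if_neg (by omega), if_neg (by omega)]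
    have h5 : (shiftVar t j (a + 1)) = 0 := by
      rw [shiftVar, if_neg (by omega), if_neg (by omega)]
    rw [h4, h5, zero_mul, zero_mul, map_zero, smul_zero, add_zero]

lemma shiftVar_zero (t : ℂ) (j : ℕ+) : shiftVar t j 0 = MvPolynomial.X j := by
  rw [shiftVar, if_pos j.pos, Nat.choose_zero_right, Nat.cast_one, one_smul]
  congr 1
  rw [Nat.sub_zero]
  exact PNat.succPNat_natPred j

/-- The coefficient of `zᵏ` in `e^{z L(t)₁}`. -/
def expL (t : ℂ) (k : ℕ) : Module.End ℂ Poly := (k.factorial : ℂ)⁻¹ • polyL t 1 ^ k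

lemma expL_zero (t : ℂ) (p : Poly) : expL t 0 p = p := by
  simp [expL]

lemma polyL_expL (t : ℂ) (k : ℕ) (p : Poly) :
    polyL t 1 (expL t k p) = ((k : ℂ) + 1) • expL t (k + 1) p := by
  have h : ((k : ℂ) + 1) ≠ 0 := Nat.cast_add_one_ne_zero k
  rw [expL, expL, LinearMap.smul_apply, LinearMap.smul_apply, map_smul, pow_succ',
    Module.End.mul_apply, smul_smul, Nat.factorial_succ]
  congr 1
  push_cast
  field_simp

lemma expL_X_mul (t : ℂ) (j : ℕ+) (k : ℕ) (p : Poly) :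
    expL t k (MvPolynomial.X j * p) =
      ∑ x ∈ Finset.HasAntidiagonal.antidiagonal k, shiftVar t j x.1 * expL t x.2 p := by
  induction k with
  | zero => simp [expL_zero, shiftVar_zero]
  | succ k ih =>
    have hk : ((k : ℂ) + 1) ≠ 0 := Nat.cast_add_one_ne_zero k
    refine smul_right_injective Poly hk ?_
    beta_reduce
    -- The factor $k+1$ is distributed as the sum of the two indices, as in the Leibniz rule.
    have h1 : ((k : ℂ) + 1) • ∑ x ∈ Finset.HasAntidiagonal.antidiagonal (k + 1), shiftVar t j x.1 * expL t x.2 p =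
        ∑ x ∈ Finset.HasAntidiagonal.antidiagonal (k + 1), (x.1 : ℂ) • (shiftVar t j x.1 * expL t x.2 p) +
        ∑ x ∈ Finset.HasAntidiagonal.antidiagonal (k + 1), (x.2 : ℂ) • (shiftVar t j x.1 * expL t x.2 p) := by
      rw [Finset.smul_sum, ← Finset.sum_add_distrib]
      refine Finset.sum_congr rfl fun x hx => ?_
      rw [← add_smul]
      congr 1
      rw [Finset.HasAntidiagonal.mem_antidiagonal] at hx
      exact_mod_cast hx.symm
    rw [← polyL_expL, ih, map_sum, h1, Finset.Nat.sum_antidiagonal_succ,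
      Finset.Nat.sum_antidiagonal_succ', Nat.cast_zero, zero_smul, zero_smul, zero_add, zero_add,
      ← Finset.sum_add_distrib]
    refine Finset.sum_congr rfl fun x _ => ?_
    rw [polyL_one_shiftVar_mul, polyL_expL, mul_smul_comm]
    push_cast
    rfl

lemma shiftVar_eq_zero (t : ℂ) {j : ℕ+} {a : ℕ} (h : (j : ℕ) < a) : shiftVar t j a = 0 := by
  rw [shiftVar, if_neg (by omega), if_neg (by omega)]

/-! ### The operator $A(z,t)$ on polynomials -/

/-- The coefficient of `z^{k - 2Δ}` in `A(z, t)`, on polynomials. -/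
def polyA (t : ℂ) (Δ : ℤ) (k : ℕ) : Poly →ₛₗ[starRingEnd ℂ] Poly :=
  Complex.exp (-(Real.pi * Complex.I * Δ)) • (expL t k).comp polyConj

lemma polyA_apply (t : ℂ) (Δ : ℤ) (k : ℕ) (p : Poly) :
    polyA t Δ k p = Complex.exp (-(Real.pi * Complex.I * Δ)) • expL t k (polyConj p) := rfl

lemma Lmode_realize (t : ℂ) (n : ℤ) (p : Poly) :
    Lmode t n (realize 0 p) = realize 0 (polyL t n p) := by
  rw [polyL_apply, realize_symbol]

lemma Acoeff_eq (t : ℂ) (Δ : ℤ) (b : V) (k : ℕ) :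
    Acoeff t Δ b k = realize 0 (polyA t Δ k (symbol 0 b)) := by
  have h : ∀ (k : ℕ) (p : Poly),
      (Lmode t 1 ^ k) (realize 0 p) = realize 0 ((polyL t 1 ^ k) p) := by
    intro k
    induction k with
    | zero => intro p; rfl
    | succ k ih =>
      intro p
      rw [pow_succ, pow_succ, Module.End.mul_apply, Module.End.mul_apply, Lmode_realize, ih]
  rw [Acoeff, phi, LinearMap.comp_apply, LinearMap.comp_apply, h, polyA_apply, expL,
    LinearMap.smul_apply, smul_smul, map_smul, mul_comm]

lemma polyConj_X_mul (j : ℕ+) (p : Poly) :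
    polyConj (MvPolynomial.X j * p) = -(MvPolynomial.X j * polyConj p) := by
  change MvPolynomial.eval₂Hom _ _ (MvPolynomial.X j * p) =
    -(MvPolynomial.X j * MvPolynomial.eval₂Hom _ _ p)
  rw [map_mul, MvPolynomial.eval₂Hom_X', neg_mul]

lemma polyConj_one : polyConj 1 = 1 :=
  map_one (MvPolynomial.eval₂Hom (MvPolynomial.C.comp (starRingEnd ℂ)) _)

lemma exp_weight_add (Δ : ℤ) (j : ℕ) :
    Complex.exp (-(Real.pi * Complex.I * ((j + Δ : ℤ) : ℂ))) =
      (-1) ^ j * Complex.exp (-(Real.pi * Complex.I * Δ)) := by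
  have h : Complex.exp (-(Real.pi * Complex.I)) = -1 := by
    rw [Complex.exp_neg, Complex.exp_pi_mul_I]
    norm_num
  rw [← h, ← Complex.exp_nat_mul, ← Complex.exp_add]
  congr 1
  push_cast
  ring

/-- Of the sign, $(-1)^j$ comes from $e^{-\pi\sqrt{-1}\,j}$ and one further $-1$ from $\phi(a)=-a$.
-/
lemma polyA_X_mul (t : ℂ) (Δ : ℤ) (j : ℕ+) (k : ℕ) (p : Poly) :
    polyA t ((j : ℕ) + Δ) k (MvPolynomial.X j * p) =
      ((-1 : ℂ) ^ ((j : ℕ) + 1)) •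
        ∑ x ∈ Finset.HasAntidiagonal.antidiagonal k, shiftVar t j x.1 * polyA t Δ x.2 p := by
  rw [polyA_apply, polyConj_X_mul, map_neg, expL_X_mul, exp_weight_add, mul_smul, pow_succ, mul_smul]
  simp only [polyA_apply, mul_smul_comm]
  rw [← Finset.smul_sum, smul_neg, neg_one_smul ℂ]

lemma polyA_one (t : ℂ) (k : ℕ) : polyA t 0 k 1 = if k = 0 then 1 else 0 := by
  rw [polyA_apply, polyConj_one, Int.cast_zero, mul_zero, neg_zero, Complex.exp_zero, one_smul]
  obtain _ | k := k
  · rw [expL_zero, if_pos rfl]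
  · rw [if_neg (Nat.succ_ne_zero k), expL, LinearMap.smul_apply, pow_succ, Module.End.mul_apply,
      polyL_one t zero_le_one, map_zero, smul_zero]

/-! ### The Hermitian form -/

/-- The square norm of a monomial. -/
def monomNorm (s : ℕ+ →₀ ℕ) : ℝ := s.prod fun j i => (i.factorial : ℝ) * ((j : ℕ) : ℝ) ^ i

lemma monomNorm_pos (s : ℕ+ →₀ ℕ) : 0 < monomNorm s :=
  Finset.prod_pos fun j _ => mul_pos (Nat.cast_pos.mpr (Nat.factorial_pos _))
    (pow_pos (Nat.cast_pos.mpr j.pos) _)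

lemma monomNorm_ofReal (s : ℕ+ →₀ ℕ) : (monomNorm s : ℂ) =
    s.prod fun j i => (i.factorial : ℂ) * ((j : ℕ) : ℂ) ^ i := by
  rw [monomNorm, Finsupp.prod, Finsupp.prod, Complex.ofReal_prod]
  push_cast
  rfl

lemma monomNorm_single_add (j : ℕ+) (s : ℕ+ →₀ ℕ) :
    monomNorm (Finsupp.single j 1 + s) = monomNorm s * ((j : ℕ) * (s j + 1)) := by
  classical
  -- Both norms are written over one index set with the factor at `j` split off, whether or not `j`
  -- occurs in `s`.
  have h : ∀ s' : ℕ+ →₀ ℕ, s'.support ⊆ insert j s.support →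
      monomNorm s' = ∏ i ∈ insert j (s.support.erase j),
        (((s' i).factorial : ℝ) * ((i : ℕ) : ℝ) ^ (s' i)) := by
    intro s' hs'
    have he : insert j (s.support.erase j) = insert j s.support := by
      ext i
      by_cases hi : i = j <;> simp [hi]
    rw [he]
    exact Finsupp.prod_of_support_subset _ hs' _ (by simp)
  rw [h s (Finset.subset_insert _ _), h (Finsupp.single j 1 + s), Finset.prod_insert (by simp),
    Finset.prod_insert (by simp)]
  · have h2 : ∏ i ∈ s.support.erase j,
        ((((Finsupp.single j 1 + s : ℕ+ →₀ ℕ) i).factorial : ℝ) *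
          ((i : ℕ) : ℝ) ^ ((Finsupp.single j 1 + s : ℕ+ →₀ ℕ) i)) =
        ∏ i ∈ s.support.erase j, (((s i).factorial : ℝ) * ((i : ℕ) : ℝ) ^ (s i)) := by
      refine Finset.prod_congr rfl fun i hi => ?_
      rw [Finsupp.add_apply, Finsupp.single_eq_of_ne (Finset.ne_of_mem_erase hi), zero_add]
    rw [h2, Finsupp.add_apply, Finsupp.single_eq_same, add_comm 1, Nat.factorial_succ, pow_succ]
    push_cast
    ring
  · refine Finsupp.support_add.trans (Finset.union_subset ?_ (Finset.subset_insert _ _))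
    exact Finsupp.support_single_subset.trans (by simp)

/-- The Hermitian form on polynomials for which the monomials are orthogonal with the given
square norms. -/
def polyForm : Poly →ₛₗ[starRingEnd ℂ] Poly →ₗ[ℂ] ℂ where
  toFun p := (MvPolynomial.basisMonomials ℕ+ ℂ).constr ℂ fun s =>
    (monomNorm s : ℂ) * starRingEnd ℂ (MvPolynomial.coeff s p)
  map_add' p q := by
    refine (MvPolynomial.basisMonomials ℕ+ ℂ).ext fun s => ?_
    simp only [LinearMap.add_apply, Module.Basis.constr_basis, MvPolynomial.coeff_add, map_add,
      mul_add]
  map_smul' c p := by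
    refine (MvPolynomial.basisMonomials ℕ+ ℂ).ext fun s => ?_
    simp only [LinearMap.smul_apply, Module.Basis.constr_basis, MvPolynomial.coeff_smul, map_mul,
      smul_eq_mul]
    ring

lemma polyForm_monomial (p : Poly) (s : ℕ+ →₀ ℕ) :
    polyForm p (MvPolynomial.monomial s 1) =
      (monomNorm s : ℂ) * starRingEnd ℂ (MvPolynomial.coeff s p) :=
  (MvPolynomial.basisMonomials ℕ+ ℂ).constr_basis ℂ _ s

lemma monomial_eq_smul (s : ℕ+ →₀ ℕ) (c : ℂ) :
    (MvPolynomial.monomial s c : Poly) = c • MvPolynomial.monomial s 1 := by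
  rw [MvPolynomial.smul_monomial, smul_eq_mul, mul_one]

lemma polyForm_eq_sum (p q : Poly) : polyForm p q = ∑ s ∈ q.support,
    (monomNorm s : ℂ) * starRingEnd ℂ (MvPolynomial.coeff s p) * MvPolynomial.coeff s q := by
  conv_lhs => rw [← MvPolynomial.support_sum_monomial_coeff q, map_sum]
  refine Finset.sum_congr rfl fun s _ => ?_
  rw [monomial_eq_smul, map_smul, polyForm_monomial, smul_eq_mul, mul_comm]

lemma polyForm_eq_sum_of_subset (p q : Poly) {F : Finset (ℕ+ →₀ ℕ)} (hF : q.support ⊆ F) :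
    polyForm p q = ∑ s ∈ F,
      (monomNorm s : ℂ) * starRingEnd ℂ (MvPolynomial.coeff s p) * MvPolynomial.coeff s q := by
  rw [polyForm_eq_sum]
  refine Finset.sum_subset hF fun s _ hs => ?_
  rw [MvPolynomial.notMem_support_iff.mp hs, mul_zero]

lemma polyForm_symm (p q : Poly) : starRingEnd ℂ (polyForm p q) = polyForm q p := by
  classical
  rw [polyForm_eq_sum_of_subset p q (Finset.subset_union_right (s₁ := p.support)),
    polyForm_eq_sum_of_subset q p (Finset.subset_union_left (s₂ := q.support)), map_sum]
  refine Finset.sum_congr rfl fun s _ => ?_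
  rw [map_mul, map_mul, Complex.conj_ofReal, Complex.conj_conj, mul_right_comm]

lemma polyForm_self (p : Poly) : polyForm p p =
    ((∑ s ∈ p.support, monomNorm s * Complex.normSq (MvPolynomial.coeff s p) : ℝ) : ℂ) := by
  rw [polyForm_eq_sum, Complex.ofReal_sum]
  refine Finset.sum_congr rfl fun s _ => ?_
  rw [mul_assoc, ← Complex.normSq_eq_conj_mul_self, Complex.ofReal_mul]

lemma polyForm_self_pos {p : Poly} (hp : p ≠ 0) :
    0 < ∑ s ∈ p.support, monomNorm s * Complex.normSq (MvPolynomial.coeff s p) :=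
  Finset.sum_pos (fun s hs => mul_pos (monomNorm_pos s)
    (Complex.normSq_pos.mpr (MvPolynomial.mem_support_iff.mp hs)))
    (Finset.nonempty_iff_ne_empty.mpr fun h => hp (MvPolynomial.support_eq_empty.mp h))

/-- Raising the exponent $i$ of $x_j$ multiplies the square norm by $j(i+1)$, and $\partial_j$
supplies the factor $i+1$. -/
lemma polyForm_X_mul (j : ℕ+) (p q : Poly) :
    polyForm p (MvPolynomial.X j * q) =
      polyForm (((j : ℕ) : ℂ) • MvPolynomial.pderiv j p) q := by
  suffices h : (polyForm p).comp (LinearMap.mulLeft ℂ (MvPolynomial.X j)) =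
      polyForm (((j : ℕ) : ℂ) • MvPolynomial.pderiv j p) from congrArg (fun f => f q) h
  refine (MvPolynomial.basisMonomials ℕ+ ℂ).ext fun s => ?_
  rw [LinearMap.comp_apply, LinearMap.mulLeft_apply, MvPolynomial.coe_basisMonomials]
  beta_reduce
  rw [← monomial_single_add, polyForm_monomial, polyForm_monomial, MvPolynomial.coeff_smul,
    MvPolynomial.coeff_pderiv, monomNorm_single_add, add_comm s]
  simp only [smul_eq_mul, map_mul, map_add, map_one, map_natCast]
  push_cast
  ring

/-- The form `H_μ` on `M(μ)`. -/
def stdForm (μ : ℂ) : SesqForm μ where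
  toFun x := (polyForm (symbol μ x)).comp (symbol μ)
  map_add' x y := by rw [map_add, map_add, LinearMap.add_comp]
  map_smul' c x := by rw [map_smul, map_smulₛₗ, LinearMap.smul_comp]

lemma stdForm_apply (μ : ℂ) (x y : Verma μ) :
    stdForm μ x y = polyForm (symbol μ x) (symbol μ y) := rfl

lemma stdForm_isSymm (μ : ℂ) : (stdForm μ).IsSymm := ⟨fun _ _ => polyForm_symm _ _⟩

lemma stdForm_monom (μ : ℂ) (s s' : ℕ+ →₀ ℕ) : stdForm μ (monom μ s) (monom μ s') =
    if s = s' then (monomNorm s : ℂ) else 0 := by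
  rw [stdForm_apply, symbol_monom, symbol_monom, polyForm_monomial, MvPolynomial.coeff_monomial]
  split_ifs with h
  · rw [h, map_one, mul_one]
  · rw [map_zero, mul_zero]

lemma stdForm_hw (μ : ℂ) : stdForm μ (hw μ) (hw μ) = 1 := by
  have h : monom μ 0 = hw μ := by
    rw [← realize_monomial, ← realize_one]
    rfl
  rw [← h, stdForm_monom, if_pos rfl]
  simp [monomNorm]

lemma stdForm_pos (μ : ℂ) {m : Verma μ} (hm : m ≠ 0) :
    0 < (stdForm μ m m).re ∧ (stdForm μ m m).im = 0 := by
  have h : symbol μ m ≠ 0 := fun h => hm (by rw [← realize_symbol μ m, h, map_zero])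
  rw [stdForm_apply, polyForm_self]
  exact ⟨polyForm_self_pos h, Complex.ofReal_im _⟩

lemma stdForm_mode_neg (μ : ℂ) (j : ℕ+) (x y : Verma μ) :
    stdForm μ x (mode μ (-((j : ℕ) : ℤ)) y) = stdForm μ (mode μ ((j : ℕ) : ℤ) x) y := by
  rw [stdForm_apply, stdForm_apply, symbol_mode, symbol_mode, polyMode_neg, polyMode_pos,
    polyForm_X_mul]

/-! ### Contravariant forms: existence, uniqueness and the condition on $t$ -/

/-- The forms for which the adjoint of `a_n` is `a_{-n} - 2t δ_{n,0}`. -/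
def IsContravariant {μ : ℂ} (t : ℂ) (H : SesqForm μ) : Prop :=
  ∀ (n : ℤ) (x y : Verma μ),
    H x (mode μ n y) = H (mode μ (-n) x + if n = 0 then (-2 * t) • x else 0) y

lemma stdForm_isContravariant {μ t : ℂ} (ht : t = Complex.I * (μ.im : ℂ)) :
    IsContravariant t (stdForm μ) := by
  intro n x y
  obtain h | rfl | h := lt_trichotomy n 0
  · obtain ⟨j, rfl⟩ : ∃ j : ℕ+, n = -((j : ℕ) : ℤ) :=
      ⟨⟨(-n).toNat, by omega⟩, by simp only [PNat.mk_coe]; omega⟩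
    rw [if_neg h.ne, add_zero, stdForm_mode_neg, neg_neg]
  -- For scalars the condition reads $\mu=\overline{\mu-2t}$, which is where the value of $t$
  -- enters.
  · rw [if_pos rfl, neg_zero, mode_zero, mode_zero, ← add_smul, map_smul, map_smulₛₗ,
      LinearMap.smul_apply]
    congr 1
    rw [ht]
    apply Complex.ext <;> simp
    ring
  · obtain ⟨j, rfl⟩ : ∃ j : ℕ+, n = ((j : ℕ) : ℤ) :=
      ⟨⟨n.toNat, by omega⟩, by simp only [PNat.mk_coe]; omega⟩
    rw [if_neg h.ne', add_zero, ← (stdForm_isSymm μ).eq, ← stdForm_mode_neg,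
      (stdForm_isSymm μ).eq]

/-- Creation operators in the first argument move to the second as annihilation operators; those
left opposite `hw μ` move back and kill it. -/
lemma IsContravariant.eq {μ t : ℂ} {H H' : SesqForm μ} (h : IsContravariant t H)
    (h' : IsContravariant t H') (h1 : H (hw μ) (hw μ) = H' (hw μ) (hw μ)) : H = H' := by
  have key : ∀ {H : SesqForm μ}, IsContravariant t H → ∀ (j : ℕ+) (x y : Verma μ),
      H x (mode μ (-((j : ℕ) : ℤ)) y) = H (mode μ ((j : ℕ) : ℤ) x) y ∧
      H (mode μ (-((j : ℕ) : ℤ)) x) y = H x (mode μ ((j : ℕ) : ℤ) y) := by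
    intro H h j x y
    have hj := j.pos
    rw [h, h, if_neg (by omega), if_neg (by omega), neg_neg, add_zero, add_zero]
    exact ⟨rfl, rfl⟩
  refine LinearMap.ext fun x => ?_
  refine verma_induction (P := fun x => H x = H' x) ?_ (fun j x hx => ?_) (fun x y hx hy => ?_)
    (fun c x hx => ?_) x
  · refine LinearMap.ext fun y => ?_
    refine verma_induction (P := fun y => H (hw μ) y = H' (hw μ) y) h1 (fun j y _ => ?_)
      (fun x y hx hy => ?_) (fun c x hx => ?_) y
    · have hj : (0 : ℤ) < (j : ℕ) := by exact_mod_cast j.pos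
      rw [(key h j _ _).1, (key h' j _ _).1, mode_pos_hw μ hj, map_zero, map_zero]
    · rw [map_add, map_add, hx, hy]
    · rw [map_smul, map_smul, hx]
  · refine LinearMap.ext fun y => ?_
    rw [(key h j _ _).2, (key h' j _ _).2, hx]
  · rw [map_add, map_add, hx, hy]
  · rw [map_smulₛₗ, map_smulₛₗ, hx]

lemma IsContravariant.eq_I_mul_im {μ t : ℂ} (ht : t.re = 0) {H : SesqForm μ}
    (h : IsContravariant t H) (h0 : H ≠ 0) : t = Complex.I * (μ.im : ℂ) := by
  obtain ⟨x, y, hxy⟩ : ∃ x y, H x y ≠ 0 := by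
    by_contra! hn
    exact h0 (LinearMap.ext fun x => LinearMap.ext fun y => hn x y)
  have h1 := h 0 x y
  rw [if_pos rfl, neg_zero, mode_zero, mode_zero, ← add_smul, map_smul, map_smulₛₗ,
    LinearMap.smul_apply] at h1
  -- Cancelling the non-zero value of the form leaves $\mu=\overline{\mu-2t}$, whose imaginary part
  -- determines $\Im t$.
  have h2 := congrArg Complex.im (smul_left_injective ℂ hxy h1)
  apply Complex.ext
  · simpa using ht
  · simp at h2 ⊢
    linarith

/-! ### Invariance -/

open Finset.HasAntidiagonal in
-- A triangular sum becomes a rectangular one, since `f` vanishes off a rectangle contained in the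
-- triangle.
lemma sum_range_sum_antidiagonal {M : Type*} [AddCommMonoid M] {f : ℕ × ℕ → M} {j K₀ K : ℕ}
    (hj : ∀ x, j < x.1 → f x = 0) (hK₀ : ∀ x, K₀ ≤ x.2 → f x = 0) (hK : K₀ + j + 1 ≤ K) :
    ∑ k ∈ Finset.range K, ∑ x ∈ antidiagonal k, f x =
      ∑ b ∈ Finset.range K₀, ∑ a ∈ Finset.range (j + 1), f (a, b) := by
  rw [← Finset.sum_product_right' (Finset.range (j + 1)) (Finset.range K₀) (fun a b => f (a, b)),
    ← Finset.sum_fiberwise_of_maps_to (s := Finset.range (j + 1) ×ˢ Finset.range K₀)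
      (t := Finset.range K) (g := fun x => x.1 + x.2) _ f]
  · refine Finset.sum_congr rfl fun k _ => (Finset.sum_subset (fun x hx => ?_) fun x hx hx' => ?_).symm
    · exact mem_antidiagonal.mpr (Finset.mem_filter.mp hx).2
    · rw [mem_antidiagonal] at hx
      rw [Finset.mem_filter, Finset.mem_product, Finset.mem_range, Finset.mem_range] at hx'
      by_cases h : j < x.1
      · exact hj x h
      · by_cases h' : K₀ ≤ x.2
        · exact hK₀ x h'
        · exact absurd ⟨⟨by omega, by omega⟩, hx⟩ hx'
  · intro x hx
    rw [Finset.mem_product, Finset.mem_range, Finset.mem_range] at hx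
    rw [Finset.mem_range]
    omega

/-- Chu-Vandermonde sums the left side to $\binom{j-m-1}{j-1}$, and the reflection
$\binom{-r}{k}=(-1)^k\binom{r+k-1}{k}$ with $k=j-1$, $r=m-k$ gives the right side. -/
lemma sum_choose_mul_modeCoeff (j : ℕ+) (m : ℤ) :
    ∑ a ∈ Finset.range j, ((j : ℕ).choose a : ℤ) * modeCoeff (j - a - 1 : ℕ).succPNat m =
      (-1) ^ ((j : ℕ) + 1) * modeCoeff j (-m) := by
  obtain ⟨k, hk⟩ : ∃ k : ℕ, (j : ℕ) = k + 1 := ⟨(j : ℕ) - 1, by have := j.pos; omega⟩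
  have h := Ring.add_choose_eq (r := ((j : ℕ) : ℤ)) (s := -m - 1) k (Commute.all _ _)
  rw [Finset.Nat.sum_antidiagonal_eq_sum_range_succ_mk] at h
  have h2 := Ring.choose_neg (m - (k : ℤ)) k
  rw [show -(m - (k : ℤ)) = ((j : ℕ) : ℤ) + (-m - 1) by rw [hk]; push_cast; ring, h] at h2
  rw [modeCoeff, hk, Nat.add_sub_cancel, show -(-m) - 1 = m - k + k - 1 by ring, pow_succ, pow_succ,
    mul_assoc _ (-1) (-1), neg_one_mul, neg_neg, mul_one]
  have h3 : ((-1 : ℤ) ^ k) * Ring.choose (m - k + k - 1) k =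
      Int.negOnePow k • Ring.choose (m - k + k - 1) k := by
    rw [Units.smul_def, smul_eq_mul, Int.negOnePow_def, zpow_natCast]
    push_cast
    rfl
  rw [h3, ← h2]
  refine Finset.sum_congr rfl fun a ha => ?_
  rw [Finset.mem_range] at ha
  rw [modeCoeff, Nat.succPNat_coe, Ring.choose_natCast, hk]
  congr 2
  omega

lemma modeCoeff_zero (j : ℕ+) : modeCoeff j 0 = (-1) ^ ((j : ℕ) + 1) := by
  obtain ⟨k, hk⟩ : ∃ k : ℕ, (j : ℕ) = k + 1 := ⟨(j : ℕ) - 1, by have := j.pos; omega⟩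
  rw [modeCoeff, hk, Nat.add_sub_cancel, show -(0 : ℤ) - 1 = -1 by ring, Ring.choose_neg,
    show (1 : ℤ) + k - 1 = (k : ℤ) by ring, Ring.choose_natCast, Nat.choose_self, pow_succ, pow_succ,
    mul_assoc, neg_one_mul, neg_neg, mul_one, Units.smul_def, smul_eq_mul, Int.negOnePow_def,
    zpow_natCast]
  push_cast
  ring

lemma sum_coeff_shiftVar_mul (μ t : ℂ) (j : ℕ+) (q : Poly) (l : ℤ) (x : Verma μ) :
    ∑ a ∈ Finset.range (j + 1), coeff (polyField μ (shiftVar t j a * q)) (l + a) x =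
      (∑ᶠ m : ℤ, ((-1) ^ ((j : ℕ) + 1) * modeCoeff j (-m)) •
        normalMode μ m (coeff (polyField μ q) (l + m + (j : ℕ))) x) +
      (-2 * t) • coeff (polyField μ q) (l + (j : ℕ)) x := by
  rw [Finset.sum_range_succ]
  congr 1
  · have h : ∀ a ∈ Finset.range j, coeff (polyField μ (shiftVar t j a * q)) (l + a) x =
        ∑ᶠ m : ℤ, (((j : ℕ).choose a : ℤ) * modeCoeff (j - a - 1 : ℕ).succPNat m) •
          normalMode μ m (coeff (polyField μ q) (l + m + (j : ℕ))) x := by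
      intro a ha
      rw [Finset.mem_range] at ha
      rw [shiftVar, if_pos ha, smul_mul_assoc, map_smul, map_smul, Pi.smul_apply,
        LinearMap.smul_apply, coeff_polyField_X_mul, Nat.cast_smul_eq_nsmul, ← natCast_zsmul,
        smul_finsum' _ (smul_normalMode_finite μ _ _ _ _ _)]
      refine finsum_congr fun m => ?_
      -- The index $(l+a)+m+(j-a)$ does not depend on $a$, so only the scalars have to be summed
      -- over $a$.
      rw [smul_smul, Nat.succPNat_coe,
        show l + a + m + ((j - a - 1 : ℕ).succ : ℤ) = l + m + (j : ℕ) by omega]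
    rw [Finset.sum_congr rfl h,
      ← finsum_sum_comm _ _ fun a _ => smul_normalMode_finite μ _ _ _ _ _]
    refine finsum_congr fun m => ?_
    rw [← Finset.sum_smul, sum_choose_mul_modeCoeff]
  · rw [shiftVar, if_neg (lt_irrefl _), if_pos rfl, ← MvPolynomial.smul_eq_C_mul, map_smul,
      map_smul]
    rfl

/-- The coefficient of `zˡ` in `Y^μ(A(z, t) p, z⁻¹)`, for `p` of weight `Δ` and large `K`. -/
def oppCoeff (μ t : ℂ) (Δ : ℤ) (p : Poly) (K : ℕ) (l : ℤ) : Module.End ℂ (Verma μ) :=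
  ∑ b ∈ Finset.range K, coeff (polyField μ (polyA t Δ b p)) (b - 2 * Δ - l)

lemma oppCoeff_apply (μ t : ℂ) (Δ : ℤ) (p : Poly) (K : ℕ) (l : ℤ) (x : Verma μ) :
    oppCoeff μ t Δ p K l x =
      ∑ b ∈ Finset.range K, coeff (polyField μ (polyA t Δ b p)) (b - 2 * Δ - l) x := by
  rw [oppCoeff, LinearMap.sum_apply]

lemma normalMode_oppCoeff (μ t : ℂ) (Δ : ℤ) (p : Poly) (K : ℕ) (l m : ℤ) (x : Verma μ) :
    normalMode μ m (oppCoeff μ t Δ p K l) x = ∑ b ∈ Finset.range K,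
      normalMode μ m (coeff (polyField μ (polyA t Δ b p)) (b - 2 * Δ - l)) x := by
  rw [oppCoeff, map_sum, LinearMap.sum_apply]

lemma smul_normalMode_finite' (μ : ℂ) (c : ℤ → ℤ) (C : VertexOperator ℂ (Verma μ)) (n : ℤ)
    {l : ℤ → ℤ} (hl : ∀ m, l m = n + m) (v : Verma μ) :
    (Function.support fun m : ℤ => c m • normalMode μ m (coeff C (l m)) v).Finite := by
  simpa only [hl, add_zero] using smul_normalMode_finite μ c C n 0 v

lemma smul_normalMode_oppCoeff_finite (μ t : ℂ) (c : ℤ → ℤ) (Δ : ℤ) (p : Poly) (K : ℕ) (n : ℤ)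
    (x : Verma μ) : (Function.support fun m : ℤ =>
      c m • normalMode μ m (oppCoeff μ t Δ p K (n - m)) x).Finite := by
  simp only [normalMode_oppCoeff, Finset.smul_sum]
  refine ((Finset.range K).finite_toSet.biUnion fun b _ =>
    smul_normalMode_finite' μ c (polyField μ (polyA t Δ b p)) (b - 2 * Δ - n)
      (l := fun m => b - 2 * Δ - (n - m)) (fun m => by ring) x).subset
      (Finset.support_sum _ _)

/-- The sign from `polyA_X_mul` cancels the one from the binomial identity in the main sum. In the
constant term $-2t$ it survives, and equals `modeCoeff j 0`, as the correction to the adjoint of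
$a_0$ requires. -/
lemma oppCoeff_X_mul (μ t : ℂ) (Δ : ℤ) (j : ℕ+) (p : Poly) {K₀ K : ℕ}
    (hK₀ : ∀ k, K₀ ≤ k → polyA t Δ k p = 0) (hK : K₀ + j + 1 ≤ K) (n : ℤ) (x : Verma μ) :
    oppCoeff μ t ((j : ℕ) + Δ) (MvPolynomial.X j * p) K n x =
      (∑ᶠ m : ℤ, modeCoeff j (-m) • normalMode μ m (oppCoeff μ t Δ p K₀ (n + (j : ℕ) - m)) x) +
      modeCoeff j 0 • (-2 * t) • oppCoeff μ t Δ p K₀ (n + (j : ℕ)) x := by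
  have h1 : oppCoeff μ t ((j : ℕ) + Δ) (MvPolynomial.X j * p) K n x =
      ((-1 : ℤ) ^ ((j : ℕ) + 1)) • ∑ k ∈ Finset.range K,
        ∑ y ∈ Finset.HasAntidiagonal.antidiagonal k,
          coeff (polyField μ (shiftVar t j y.1 * polyA t Δ y.2 p))
            ((y.2 : ℤ) - 2 * Δ - 2 * (j : ℕ) - n + y.1) x := by
    rw [oppCoeff_apply, Finset.smul_sum]
    refine Finset.sum_congr rfl fun k _ => ?_
    rw [polyA_X_mul, map_smul, map_smul, Pi.smul_apply, LinearMap.smul_apply, map_sum, map_sum,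
      Finset.sum_apply, LinearMap.sum_apply, ← Int.cast_smul_eq_zsmul ℂ]
    push_cast
    congr 1
    refine Finset.sum_congr rfl fun y hy => ?_
    rw [Finset.HasAntidiagonal.mem_antidiagonal] at hy
    rw [← hy]
    congr 2
    push_cast
    ring_nf
  rw [h1, sum_range_sum_antidiagonal (j := j) (K₀ := K₀) _ _ hK]
  · have h2 : ∀ b ∈ Finset.range K₀, ∑ a ∈ Finset.range (j + 1),
        coeff (polyField μ (shiftVar t j a * polyA t Δ b p))
          ((b : ℤ) - 2 * Δ - 2 * (j : ℕ) - n + a) x = _ := fun b _ =>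
      sum_coeff_shiftVar_mul μ t j (polyA t Δ b p) ((b : ℤ) - 2 * Δ - 2 * (j : ℕ) - n) x
    dsimp only
    rw [Finset.sum_congr rfl h2, Finset.sum_add_distrib, smul_add]
    congr 1
    · rw [← finsum_sum_comm _ _ fun b _ => smul_normalMode_finite μ _ _ _ _ _, smul_finsum']
      · refine finsum_congr fun m => ?_
        rw [← Finset.smul_sum, smul_smul, ← mul_assoc, ← pow_add, Even.neg_one_pow ⟨_, rfl⟩, one_mul,
          normalMode_oppCoeff]
        congr 1
        refine Finset.sum_congr rfl fun b _ => ?_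
        congr 3
        ring_nf
      · exact ((Finset.range K₀).finite_toSet.biUnion fun b _ =>
          smul_normalMode_finite μ _ (polyField μ (polyA t Δ b p)) _ _ x).subset
            (Finset.support_sum _ _)
    · rw [modeCoeff_zero, ← Finset.smul_sum, oppCoeff_apply]
      congr 2
      refine Finset.sum_congr rfl fun b _ => ?_
      congr 2
      ring_nf
  · intro y hy
    rw [shiftVar_eq_zero t hy, zero_mul, map_zero, map_zero]
    rfl
  · intro y hy
    rw [hK₀ _ hy, mul_zero, map_zero, map_zero]
    rfl

/-- Taking adjoints reverses products and exchanges creation with annihilation, so normal ordering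
is preserved. For $m=0$ both modes stand on the right, which is harmless because $a_0$ is a scalar.
-/
lemma IsContravariant.normalMode {μ t : ℂ} {H : SesqForm μ} (h : IsContravariant t H)
    {P Q : Module.End ℂ (Verma μ)} (hPQ : ∀ x y, H x (P y) = H (Q x) y) (m : ℤ)
    (x y : Verma μ) : H x (normalMode μ m P y) =
      H (normalMode μ (-m) Q x + if m = 0 then (-2 * t) • Q x else 0) y := by
  obtain hm | rfl | hm := lt_trichotomy m 0
  · rw [normalMode_neg hm, normalMode_nonneg (by omega), h, if_neg hm.ne, if_neg hm.ne, add_zero,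
      add_zero, hPQ]
  · rw [normalMode_nonneg le_rfl, hPQ, h, neg_zero, normalMode_nonneg le_rfl, mode_zero, mode_zero,
      map_smul]
  · rw [normalMode_nonneg hm.le, normalMode_neg (by omega), hPQ, h, if_neg hm.ne']

/-! ### From contravariance to invariance, by induction on monomials -/

/-- The invariance of a form for the states of weight `Δ` that correspond to `p`. -/
def IsInvariantFor {μ : ℂ} (t : ℂ) (H : SesqForm μ) (Δ : ℤ) (p : Poly) : Prop :=
  ∃ K₀ : ℕ, (∀ k, K₀ ≤ k → polyA t Δ k p = 0) ∧ ∀ (n : ℤ) (x y : Verma μ),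
    H x (coeff (polyField μ p) n y) = H (oppCoeff μ t Δ p K₀ n x) y

lemma oppCoeff_eq (μ t : ℂ) (Δ : ℤ) (p : Poly) {K₀ K : ℕ}
    (hK₀ : ∀ k, K₀ ≤ k → polyA t Δ k p = 0) (hK : K₀ ≤ K) (l : ℤ) :
    oppCoeff μ t Δ p K l = oppCoeff μ t Δ p K₀ l := by
  refine (Finset.sum_subset (Finset.range_subset_range.mpr hK) fun k _ hk => ?_).symm
  rw [hK₀ k (by simpa using hk), map_zero, map_zero]
  rfl

lemma IsInvariantFor.one {μ t : ℂ} (H : SesqForm μ) :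
    IsInvariantFor t H 0 1 := by
  refine ⟨1, fun k hk => ?_, fun n x y => ?_⟩
  · rw [polyA_one, if_neg (by omega)]
  · rw [oppCoeff_apply, Finset.sum_range_one, polyA_one, if_pos rfl, polyField_one, coeff_idField,
      coeff_idField]
    by_cases hn : n = 0
    · rw [if_pos hn, if_pos (by simp [hn])]
    · rw [if_neg hn, if_neg (by simpa using hn), map_zero, map_zero, LinearMap.zero_apply]

/-- The factor $e^{zL(t)_1}x_j$ has degree at most $j$ in $z$, so truncation is inherited. -/
lemma polyA_X_mul_eq_zero (t : ℂ) (Δ : ℤ) (j : ℕ+) (p : Poly) {K₀ : ℕ}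
    (hK₀ : ∀ k, K₀ ≤ k → polyA t Δ k p = 0) (k : ℕ) (hk : K₀ + j + 1 ≤ k) :
    polyA t ((j : ℕ) + Δ) k (MvPolynomial.X j * p) = 0 := by
  rw [polyA_X_mul, Finset.sum_eq_zero, smul_zero]
  intro x hx
  rw [Finset.HasAntidiagonal.mem_antidiagonal] at hx
  by_cases h : (j : ℕ) < x.1
  · rw [shiftVar_eq_zero t h, zero_mul]
  · rw [hK₀ _ (by omega), mul_zero]

lemma IsContravariant.isInvariantFor_X_mul {μ t : ℂ} {H : SesqForm μ} (h : IsContravariant t H)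
    {Δ : ℤ} {p : Poly} (hp : IsInvariantFor t H Δ p) (j : ℕ+) :
    IsInvariantFor t H ((j : ℕ) + Δ) (MvPolynomial.X j * p) := by
  obtain ⟨K₀, hK₀, hp⟩ := hp
  refine ⟨K₀ + j + 1, polyA_X_mul_eq_zero t Δ j p hK₀, fun n x y => ?_⟩
  have hfin := smul_normalMode_oppCoeff_finite μ t (fun m => modeCoeff j (-m)) Δ p K₀
    (n + (j : ℕ)) x
  have h2 : ∀ m : ℤ, H x (modeCoeff j m • FreeBoson.normalMode μ m
      (coeff (polyField μ p) (n + m + (j : ℕ))) y) =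
      modeCoeff j m • H (FreeBoson.normalMode μ (-m)
        (oppCoeff μ t Δ p K₀ (n + (j : ℕ) - (-m))) x) y +
      if m = 0 then modeCoeff j 0 • H ((-2 * t) • oppCoeff μ t Δ p K₀ (n + (j : ℕ)) x) y else 0 := by
    intro m
    rw [map_zsmul, h.normalMode (hp _), show n + (j : ℕ) - -m = n + m + (j : ℕ) by ring, map_add,
      LinearMap.add_apply, smul_add]
    congr 1
    split_ifs with hm
    · rw [hm, add_zero]
    · rw [map_zero, LinearMap.zero_apply, smul_zero]
  have hfin2 : (Function.support fun m : ℤ => modeCoeff j m • H (FreeBoson.normalMode μ (-m)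
        (oppCoeff μ t Δ p K₀ (n + (j : ℕ) - (-m))) x) y).Finite := by
    refine (hfin.preimage (neg_injective.injOn)).subset fun m hm h0 => hm ?_
    have h1 := congrArg (fun v => H v y) h0
    simpa only [neg_neg, map_zsmul, LinearMap.smul_apply, map_zero, LinearMap.zero_apply] using h1
  rw [oppCoeff_X_mul μ t Δ j p hK₀ le_rfl, coeff_polyField_X_mul,
    map_finsum _ (smul_normalMode_finite μ _ _ _ _ _), finsum_congr h2,
    finsum_add_distrib hfin2 (if_eq_finite _ _), finsum_if_eq, map_add, LinearMap.add_apply,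
    map_zsmul, LinearMap.smul_apply]
  congr 1
  -- Adjunction turned mode $m$ into $-m$; reindexing by negation matches the two sums.
  rw [← LinearMap.flip_apply, map_finsum _ hfin, ← finsum_comp_equiv (Equiv.neg ℤ)]
  refine finsum_congr fun m => ?_
  simp only [Equiv.neg_apply, neg_neg, map_zsmul, LinearMap.flip_apply]

lemma IsContravariant.isInvariantFor_monomial {μ t : ℂ} {H : SesqForm μ}
    (h : IsContravariant t H) (s : ℕ+ →₀ ℕ) :
    IsInvariantFor t H (monomWeight s) (MvPolynomial.monomial s 1) := by
  refine exponent_induction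
    (P := fun s => IsInvariantFor t H (monomWeight s) (MvPolynomial.monomial s 1)) ?_
    (fun j s hs => ?_) s
  · exact IsInvariantFor.one H
  · rw [monomial_single_add, monomWeight_single_add, Nat.cast_add]
    exact h.isInvariantFor_X_mul hs j

lemma IsInvariantFor.add {μ t : ℂ} {H : SesqForm μ} {Δ : ℤ} {p q : Poly}
    (hp : IsInvariantFor t H Δ p) (hq : IsInvariantFor t H Δ q) :
    IsInvariantFor t H Δ (p + q) := by
  obtain ⟨K, hK, hp⟩ := hp
  obtain ⟨N, hN, hq⟩ := hq
  refine ⟨max K N, fun k hk => ?_, fun n x y => ?_⟩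
  · rw [map_add, hK k (le_of_max_le_left hk), hN k (le_of_max_le_right hk), add_zero]
  · have h : oppCoeff μ t Δ (p + q) (max K N) n = oppCoeff μ t Δ p K n + oppCoeff μ t Δ q N n := by
      rw [← oppCoeff_eq μ t Δ p hK (le_max_left K N), ← oppCoeff_eq μ t Δ q hN (le_max_right K N),
        oppCoeff, oppCoeff, oppCoeff, ← Finset.sum_add_distrib]
      refine Finset.sum_congr rfl fun b _ => ?_
      rw [map_add, map_add, map_add, Pi.add_apply]
    rw [h, map_add, map_add, Pi.add_apply, LinearMap.add_apply, map_add, hp, hq, LinearMap.add_apply,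
      map_add, LinearMap.add_apply]

lemma IsInvariantFor.smul {μ t : ℂ} {H : SesqForm μ} {Δ : ℤ} {p : Poly} (c : ℂ)
    (hp : IsInvariantFor t H Δ p) : IsInvariantFor t H Δ (c • p) := by
  obtain ⟨K, hK, hp⟩ := hp
  refine ⟨K, fun k hk => by rw [map_smulₛₗ, hK k hk, smul_zero], fun n x y => ?_⟩
  have h : oppCoeff μ t Δ (c • p) K n = starRingEnd ℂ c • oppCoeff μ t Δ p K n := by
    rw [oppCoeff, oppCoeff, Finset.smul_sum]
    refine Finset.sum_congr rfl fun b _ => ?_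
    rw [map_smulₛₗ, map_smul, map_smul, Pi.smul_apply]
  rw [h, map_smul, map_smul, Pi.smul_apply, LinearMap.smul_apply, map_smul, hp,
    LinearMap.smul_apply, map_smulₛₗ, Complex.conj_conj, LinearMap.smul_apply]

lemma IsInvariantFor.zero {μ t : ℂ} (H : SesqForm μ) (Δ : ℤ) : IsInvariantFor t H Δ 0 := by
  refine ⟨0, fun k _ => map_zero _, fun n x y => ?_⟩
  rw [oppCoeff_apply, Finset.sum_range_zero, map_zero, map_zero, Pi.zero_apply,
    LinearMap.zero_apply, map_zero, map_zero, LinearMap.zero_apply]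

lemma finsum_eq_oppCoeff {μ t : ℂ} {H : SesqForm μ} {Δ : ℤ} {p : Poly} {K : ℕ}
    (hK : ∀ k, K ≤ k → polyA t Δ k p = 0) (n : ℤ) (x y : Verma μ) :
    ∑ᶠ k : ℕ, H (coeff (polyField μ (polyA t Δ k p)) ((k : ℤ) - 2 * Δ - n) x) y =
      H (oppCoeff μ t Δ p K n x) y := by
  rw [finsum_eq_sum_of_support_subset (s := Finset.range K), oppCoeff_apply, map_sum,
    LinearMap.sum_apply]
  intro k hk
  rw [Finset.coe_range, Set.mem_Iio]
  by_contra h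
  refine hk ?_
  beta_reduce
  rw [hK k (not_lt.mp h), map_zero, map_zero, Pi.zero_apply, LinearMap.zero_apply, map_zero,
    LinearMap.zero_apply]

lemma Ycoeff_Acoeff (μ t : ℂ) (Δ : ℤ) (b : V) (k : ℕ) (n : ℤ) :
    Ycoeff μ (Acoeff t Δ b k) n = coeff (polyField μ (polyA t Δ k (symbol 0 b))) n := by
  rw [Acoeff_eq, Ycoeff_realize]

theorem IsContravariant.isInvariantForm {μ t : ℂ} {H : SesqForm μ} (h : IsContravariant t H) :
    IsInvariantForm μ t H := by
  intro Δ b hb x y n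
  -- `polyA` depends on the weight, so the monomials of `b` can be treated separately only because
  -- all have weight `Δ`.
  have hw : ∀ s ∈ (symbol 0 b).support, (monomWeight s : ℤ) = Δ := by
    intro s hs
    have h1 := coeff_polyL_zero t s (symbol 0 b)
    rw [polyL_apply, realize_symbol, hb, map_smul, MvPolynomial.coeff_smul, smul_eq_mul] at h1
    exact_mod_cast (mul_right_cancel₀ (MvPolynomial.mem_support_iff.mp hs) h1).symm
  have hp : IsInvariantFor t H Δ (symbol 0 b) := by
    rw [MvPolynomial.as_sum (symbol 0 b)]
    refine Finset.sum_induction _ (IsInvariantFor t H Δ) (fun _ _ => IsInvariantFor.add)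
      (IsInvariantFor.zero H Δ) fun s hs => ?_
    rw [monomial_eq_smul, ← hw s hs]
    exact (h.isInvariantFor_monomial s).smul _
  obtain ⟨K, hK, hp⟩ := hp
  simp only [Ycoeff_Acoeff]
  rw [finsum_eq_oppCoeff hK, ← hp, Ycoeff, Y_eq_polyField]

theorem isContravariant_of_isInvariantForm {μ t : ℂ} {H : SesqForm μ}
    (h : IsInvariantForm μ t H) : IsContravariant t H := by
  intro n x y
  have hX : (MvPolynomial.X 1 : Poly) = MvPolynomial.X 1 * 1 := (mul_one _).symm
  have h1 : Lmode t 0 aState = ((1 : ℤ) : ℂ) • aState := by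
    rw [aState_eq, Lmode_realize, hX, polyL_X_mul, polyL_one t le_rfl, mul_zero, zero_add, zero_sub,
      polyMode_neg, if_neg (by norm_num), add_zero]
    simp
  -- The coefficient of $z^{-n-1}$ in $a(z)$ is $a_n$.
  have h2 := h 1 aState h1 x y (-n - 1)
  have hK : ∀ k, 1 ≤ k → polyA t 0 k 1 = 0 := fun k hk => by rw [polyA_one, if_neg (by omega)]
  have h3 := polyA_X_mul_eq_zero t 0 1 1 hK
  have h4 := oppCoeff_X_mul μ t 0 1 1 hK le_rfl (-n - 1) x
  simp only [Ycoeff_Acoeff] at h2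
  rw [Ycoeff, Y_eq_polyField, aState_eq, symbol_realize, coeff_polyField_X, modeCoeff_one, one_smul,
    hX] at h2
  -- Writing the weight as $1+0$ and the state as $x_1\cdot1$ makes `oppCoeff_X_mul` applicable with
  -- the vacuum as second factor.
  change _ = ∑ᶠ k : ℕ, H (coeff (polyField μ (polyA t (((1 : ℕ+) : ℕ) + 0) k _))
    ((k : ℤ) - 2 * (((1 : ℕ+) : ℕ) + 0) - _) x) y at h2
  have h5 : ∀ l z, oppCoeff μ t 0 1 1 l z = if l = 0 then z else 0 := by
    intro l z
    rw [oppCoeff_apply, Finset.sum_range_one, polyA_one, if_pos rfl, polyField_one, coeff_idField]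
    simp
  -- The opposite field of the vacuum is the identity (`h5`), so only the mode $-n$ survives.
  rw [finsum_eq_oppCoeff h3, h4, finsum_eq_single _ (-n)] at h2
  · have e1 : -(-n - 1) - (((1 : ℕ+) : ℕ) : ℤ) = n := by
      change -(-n - 1) - 1 = n
      ring
    have e2 : -n - 1 + (((1 : ℕ+) : ℕ) : ℤ) = -n := by
      change -n - 1 + 1 = -n
      ring
    rw [e1, e2, modeCoeff_one, modeCoeff_one, one_smul, one_smul, h5, sub_self] at h2
    rw [h2]
    congr 3
    · by_cases hn : -n < 0
      · rw [normalMode_neg hn, h5, if_pos rfl]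
      · rw [normalMode_nonneg (not_lt.mp hn), h5, if_pos rfl]
    · simp only [neg_eq_zero, smul_ite, smul_zero]
  · intro m hm
    have e2 : -n - 1 + (((1 : ℕ+) : ℕ) : ℤ) - m ≠ 0 := by
      change -n - 1 + 1 - m ≠ 0
      omega
    by_cases hn : m < 0
    · rw [normalMode_neg hn, h5, if_neg e2, map_zero, smul_zero]
    · rw [normalMode_nonneg (not_lt.mp hn), h5, if_neg e2, smul_zero]

end FreeBoson

end

theorem mainTheorem11 (μ t : ℂ) (ht : t.re = 0) :
    ((∃ H : FreeBoson.SesqForm μ, H.IsSymm ∧ H ≠ 0 ∧ FreeBoson.IsInvariantForm μ t H) ↔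
      t = Complex.I * (μ.im : ℂ)) ∧
    (t = Complex.I * (μ.im : ℂ) →
      ∃ H : FreeBoson.SesqForm μ,
        H.IsSymm ∧ FreeBoson.IsInvariantForm μ t H ∧
        H (FreeBoson.hw μ) (FreeBoson.hw μ) = 1 ∧
        (∀ H' : FreeBoson.SesqForm μ, H'.IsSymm → FreeBoson.IsInvariantForm μ t H' →
          H' (FreeBoson.hw μ) (FreeBoson.hw μ) = 1 → H' = H) ∧
        (∀ m : FreeBoson.Verma μ, m ≠ 0 → 0 < (H m m).re ∧ (H m m).im = 0) ∧
        (∃ B : Module.Basis (ℕ+ →₀ ℕ) ℂ (FreeBoson.Verma μ),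
          (∀ s, B s = FreeBoson.monom μ s) ∧
          (∀ s s', s ≠ s' → H (B s) (B s') = 0) ∧
          (∀ s, H (B s) (B s) =
            s.prod fun j i => ((i.factorial : ℂ) * ((j : ℕ) : ℂ) ^ i)))) := by
  refine ⟨⟨fun ⟨H, _, h0, hH⟩ =>
    (FreeBoson.isContravariant_of_isInvariantForm hH).eq_I_mul_im ht h0, fun h =>
      ⟨FreeBoson.stdForm μ, FreeBoson.stdForm_isSymm μ, fun h0 => ?_,
        (FreeBoson.stdForm_isContravariant h).isInvariantForm⟩⟩, fun h =>
    ⟨FreeBoson.stdForm μ, FreeBoson.stdForm_isSymm μ,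
      (FreeBoson.stdForm_isContravariant h).isInvariantForm, FreeBoson.stdForm_hw μ,
      fun H' _ hH' h1 => ?_, fun m hm => FreeBoson.stdForm_pos μ hm, FreeBoson.monomBasis μ,
      FreeBoson.monomBasis_apply μ, fun s s' hs => ?_, fun s => ?_⟩⟩
  · have h1 := FreeBoson.stdForm_hw μ
    rw [h0, LinearMap.zero_apply, LinearMap.zero_apply] at h1
    exact zero_ne_one h1
  · exact (FreeBoson.isContravariant_of_isInvariantForm hH').eq
      (FreeBoson.stdForm_isContravariant h) (h1.trans (FreeBoson.stdForm_hw μ).symm)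
  · rw [FreeBoson.monomBasis_apply, FreeBoson.monomBasis_apply, FreeBoson.stdForm_monom, if_neg hs]
  · rw [FreeBoson.monomBasis_apply, FreeBoson.stdForm_monom, if_pos rfl,
      FreeBoson.monomNorm_ofReal]
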